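/- Write $\mathbf{N}=\{1,2,3,\dots\}$. For sets $X=\{x_1<\dots<x_m\}$ and $Y=\{y_1<\dots<y_m\}$ of natural numbers write $X\preceq Y$ if $x_i\le y_i$ for all $i$. A *set family of shape* $(m^n)$ is a collection of $n$ distinct $m$-subsets of $\mathbf{N}$; it has *type* $\lambda$, for a partition $\lambda$ of $mn$ with conjugate $\lambda'$ and largest part $a$, if exactly $\lambda'_i$ of its sets contain $i$, for each $1\le i\le a$ (by counting, no set then contains a number greater than $a$); and it is *closed* if it contains every $X$ with $X\prec Y$ for some member $Y$. Let $H^{(m^n)}$ be the permutation module for $\mathbf{Z}S_{mn}$ on the set partitions of a set of size $mn$ into $n$ sets of size $m$, and let $\phi^{(m^n)}$ be its character. For a partition $\lambda$ of $mn$ let $A(\lambda)$ be the set of symbols $i_j$ with $1\le i\le a$ and $1\le j\le\lambda'_i$, and identify $S_{mn}$ with the symmetric group on $A(\lambda)$ by any bijection of the underlying sets. Modules are right modules. For a $\lambda$-tableau $t$ with entries from $A(\lambda)$, let $\mathbf{t}$ be its tabloid, $C(t)$ its column stabilizer, $b_t=\sum_{\tau\in C(t)}\operatorname{sgn}(\tau)\,\tau$,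 and $e_t=\mathbf{t}\,b_t$; the Specht module $S^\lambda$ is the $\mathbf{Z}$-span of the polytabloids $e_t$, and $\chi^\lambda$ is the character of $S^\lambda\otimes_{\mathbf{Z}}\mathbf{Q}$. Let $t_\lambda$ be the tableau whose $i$-th column is $i_1,i_2,\dots,i_{\lambda'_i}$ from top to bottom. We say that $\chi^\lambda$ is a *minimal constituent* of $\phi^{(m^n)}$ if $\langle\phi^{(m^n)},\chi^\lambda\rangle\ge1$ and $\langle\phi^{(m^n)},\chi^\mu\rangle=0$ for every partition $\mu\ne\lambda$ of $mn$ that $\lambda$ dominates. For a set family $\mathcal{P}$ of shape $(m^n)$ and type $\lambda$, list its sets in lexicographic order as $X_1<\dots<X_n$ and replace each $i\in X_r$ by $i_j$, where $j$ is the smallest index not yet appended to $i$ in $X_1,\dots,X_{r-1}$; let $u_{\mathcal{P}}\in H^{(m^n)}$ be the resulting set partition of $A(\lambda)$. When it exists, let $f_{\mathcal{P}}:S^\lambda\to H^{(m^n)}$ be the (necessarily unique) $\mathbf{Z}S_{mn}$-homomorphism with $e_{t_\lambda}f_{\mathcal{P}}=u_{\mathcal{P}}\,b_{t_\lambda}$.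 **Theorem.** Let $m$ be odd, let $n$ be a natural number, let $\lambda$ be a partition of $mn$, and suppose that $\chi^\lambda$ is a minimal constituent of $\phi^{(m^n)}$. Then there are only finitely many set families $\mathcal{P}_1,\dots,\mathcal{P}_d$ of shape $(m^n)$ and type $\lambda$, and all of them are closed. The homomorphisms $f_{\mathcal{P}_1},\dots,f_{\mathcal{P}_d}$ exist and form a $\mathbf{Z}$-basis of $\operatorname{Hom}_{\mathbf{Z}S_{mn}}(S^\lambda,H^{(m^n)})$. In particular, $\langle\phi^{(m^n)},\chi^\lambda\rangle=d$. -/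

import Mathlib

open scoped TensorProduct

namespace SetFamilies

/-! ### Set families

The natural numbers start at `0` here, in line with the numbering of the rows and columns of
`YoungDiagram`: the `i`-th smallest natural number, the `i`-th row and the `i`-th column are
numbered `i - 1`. -/

/-- `Majorizes Y X`, that is `X ⪯ Y`: both sets have the same size `k`, and when they are listed
increasingly, `x₁ < ⋯ < x_k` and `y₁ < ⋯ < y_k`, then `x_i ≤ y_i` for each `i`. -/
def Majorizes (Y X : Finset ℕ) : Prop :=
  ∃ (k : ℕ) (hX : X.card = k) (hY : Y.card = k),
    ∀ i : Fin k, X.orderEmbOfFin hX i ≤ Y.orderEmbOfFin hY i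

/-- A set family of shape `(m^n)`: a collection of `n` distinct `m`-subsets of `ℕ`. -/
def IsSetFamily (m n : ℕ) (P : Finset (Finset ℕ)) : Prop :=
  P.card = n ∧ ∀ X ∈ P, X.card = m

/-- A family is closed if `Y ∈ P` and `X ≺ Y` imply `X ∈ P`. -/
def IsClosedFamily (P : Finset (Finset ℕ)) : Prop :=
  ∀ Y ∈ P, ∀ X : Finset ℕ, Majorizes Y X → X ≠ Y → X ∈ P

/-- A family has type `lam` if the `i`-th natural number lies in exactly `lam'_i` of its sets,
where `lam'_i` is the length of the `i`-th column of `lam` (and `0` beyond the last column: for a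
family of shape `(m^n)` and a partition `lam` of `m * n`, those numbers are excluded by counting
as soon as the condition holds for the columns of `lam`). -/
def HasType (P : Finset (Finset ℕ)) (lam : YoungDiagram) : Prop :=
  ∀ i : ℕ, (P.filter (fun X => i ∈ X)).card = lam.colLen i

/-- The set families of shape `(m^n)` and type `lam`. -/
abbrev FamilyOfType (m n : ℕ) (lam : YoungDiagram) : Type :=
  {P : Finset (Finset ℕ) // IsSetFamily m n P ∧ HasType P lam}

/-- The lexicographic order on finite sets of naturals, listed increasingly. -/
def LexLT (Y X : Finset ℕ) : Prop := Y.sort < X.sort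

instance : DecidableRel LexLT := fun Y X => inferInstanceAs (Decidable (Y.sort < X.sort))

/-! ### Partitions and dominance -/

/-- `Dominates lam mu`: every partial sum of the parts of `lam` is at least that of `mu`. -/
def Dominates (lam mu : YoungDiagram) : Prop :=
  ∀ j : ℕ, ∑ i ∈ Finset.range j, mu.rowLen i ≤ ∑ i ∈ Finset.range j, lam.rowLen i

/-! ### Tableaux, tabloids and Specht modules

Groups act from the left: a right action of `σ` becomes the left action of `σ⁻¹`. The signed
column sums below are invariant under inversion. -/

/-- The boxes of a Young diagram, `(row, column)`. -/
abbrev Box (lam : YoungDiagram) : Type := {c : ℕ × ℕ // c ∈ lam.cells}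

/-- A `lam`-tableau with entries `Fin r`: a bijective filling of the boxes. -/
abbrev Tableau (lam : YoungDiagram) (r : ℕ) : Type := Box lam ≃ Fin r

/-- The row of the tableau `t` that contains the entry `x`. -/
def Tableau.rowOf {lam : YoungDiagram} {r : ℕ} (t : Tableau lam r) (x : Fin r) : ℕ :=
  (t.symm x).1.1

/-- The column of the tableau `t` that contains the entry `x`. -/
def Tableau.colOf {lam : YoungDiagram} {r : ℕ} (t : Tableau lam r) (x : Fin r) : ℕ :=
  (t.symm x).1.2

/-- Two tableaux are row equivalent if their rows have the same sets of entries. -/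
def rowSetoid (lam : YoungDiagram) (r : ℕ) : Setoid (Tableau lam r) where
  r t t' := ∀ x, Tableau.rowOf t x = Tableau.rowOf t' x
  iseqv := ⟨fun _ _ => rfl, fun h x => (h x).symm, fun h h' x => (h x).trans (h' x)⟩

/-- Tabloids: tableaux up to row equivalence. -/
abbrev Tabloid (lam : YoungDiagram) (r : ℕ) : Type := Quotient (rowSetoid lam r)

/-- The tabloid of a tableau. -/
def Tableau.tabloid {lam : YoungDiagram} {r : ℕ} (t : Tableau lam r) : Tabloid lam r :=
  Quotient.mk (rowSetoid lam r) t

/-- Permutations act on tabloids by permuting the entries. -/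
instance tabloidAction (lam : YoungDiagram) (r : ℕ) :
    MulAction (Equiv.Perm (Fin r)) (Tabloid lam r) where
  smul σ := Quotient.map (fun t : Tableau lam r => t.trans σ)
    (fun _ _ h x => h (σ.symm x))
  one_smul := by rintro ⟨t⟩; rfl
  mul_smul := by rintro σ τ ⟨t⟩; rfl

theorem smul_tabloid {lam : YoungDiagram} {r : ℕ} (σ : Equiv.Perm (Fin r)) (t : Tableau lam r) :
    σ • Tableau.tabloid t = Tableau.tabloid (t.trans σ) := rfl

/-- The Young permutation module `M^lam`: the free `ℤ`-module on the tabloids. -/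
noncomputable abbrev youngRep (lam : YoungDiagram) (r : ℕ) :
    Representation ℤ (Equiv.Perm (Fin r)) (MonoidAlgebra ℤ (Tabloid lam r)) :=
  Representation.ofMulAction ℤ (Equiv.Perm (Fin r)) (Tabloid lam r)

/-- The group `C(t)` of permutations that fix the columns of `t` setwise. -/
def columnGroup {lam : YoungDiagram} {r : ℕ} (t : Tableau lam r) :
    Subgroup (Equiv.Perm (Fin r)) where
  carrier := {σ | ∀ x, Tableau.colOf t (σ x) = Tableau.colOf t x}
  one_mem' := fun _ => rfl
  mul_mem' := fun {a b} ha hb x => (ha (b x)).trans (hb x)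
  inv_mem' := fun {a} ha x => by
    have h := ha (a⁻¹ x)
    have h' : a (a⁻¹ x) = x := by simp
    rw [h'] at h
    exact h.symm

open Classical in
/-- The signed column sum `b_t = ∑ sgn(τ) τ` over `τ ∈ C(t)`, in the group ring. -/
noncomputable def columnSum {lam : YoungDiagram} {r : ℕ} (t : Tableau lam r) :
    MonoidAlgebra ℤ (Equiv.Perm (Fin r)) :=
  ∑ τ : Equiv.Perm (Fin r) with τ ∈ columnGroup t,
    MonoidAlgebra.single τ ((Equiv.Perm.sign τ : ℤˣ) : ℤ)

/-- The polytabloid `e_t`, the tabloid of `t` acted on by `b_t`. -/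
noncomputable def polytabloid {lam : YoungDiagram} {r : ℕ} (t : Tableau lam r) :
    MonoidAlgebra ℤ (Tabloid lam r) :=
  (youngRep lam r).asAlgebraHom (columnSum t) (MonoidAlgebra.single (Tableau.tabloid t) 1)

/-- The Specht module, as the submodule of `M^lam` spanned by the polytabloids. -/
noncomputable def spechtModule (lam : YoungDiagram) (r : ℕ) :
    Submodule ℤ (MonoidAlgebra ℤ (Tabloid lam r)) :=
  Submodule.span ℤ (Set.range (polytabloid (lam := lam) (r := r)))

theorem perm_polytabloid {lam : YoungDiagram} {r : ℕ} (σ : Equiv.Perm (Fin r))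
    (t : Tableau lam r) :
    youngRep lam r σ (polytabloid t) = polytabloid (t.trans σ) := by
  classical
  simp only [polytabloid, columnSum, map_sum, Representation.asAlgebraHom_single,
    LinearMap.sum_apply, LinearMap.smul_apply, map_smul, Representation.ofMulAction_single]
  refine Finset.sum_bij (fun τ _ => σ * τ * σ⁻¹) ?_ ?_ ?_ ?_
  · intro τ hτ
    simp only [Finset.mem_filter, Finset.mem_univ, true_and] at hτ ⊢
    intro x
    have h := hτ (σ⁻¹ x)
    simpa [Tableau.colOf] using h
  · intro a _ b _ h
    simpa using h
  · intro b hb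
    refine ⟨σ⁻¹ * b * σ, ?_, by group⟩
    simp only [Finset.mem_filter, Finset.mem_univ, true_and] at hb ⊢
    intro x
    have h := hb (σ x)
    simpa [Tableau.colOf] using h
  · intro τ _
    have h1 : Equiv.Perm.sign (σ * τ * σ⁻¹) = Equiv.Perm.sign τ := by
      rw [Equiv.Perm.sign_mul, mul_comm, ← Equiv.Perm.sign_mul]
      simp
    have h2 : (σ * τ * σ⁻¹) • Tableau.tabloid (t.trans σ) = σ • τ • Tableau.tabloid t := by
      simp [← smul_tabloid, mul_smul]
    rw [h1, h2]

/-- The Specht module `S^lam` for the integral group ring. -/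
noncomputable def spechtRep (lam : YoungDiagram) (r : ℕ) :
    Representation ℤ (Equiv.Perm (Fin r)) (spechtModule lam r) :=
  (youngRep lam r).subrepresentation (spechtModule lam r) (fun σ => by
    rw [spechtModule, Submodule.span_le]
    rintro _ ⟨t, rfl⟩
    change youngRep lam r σ (polytabloid t) ∈ Submodule.span ℤ _
    rw [perm_polytabloid σ t]
    exact Submodule.subset_span ⟨_, rfl⟩)

/-- The polytabloid `e_t` as an element of `S^lam`. -/
noncomputable def spechtGen {lam : YoungDiagram} {r : ℕ} (t : Tableau lam r) :
    spechtModule lam r :=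
  ⟨polytabloid t, Submodule.subset_span ⟨t, rfl⟩⟩

/-! ### Foulkes modules -/

/-- `p` is a set partition of `Fin r` into `n` sets, each of size `m` (where `0 < m`). -/
def IsSetPartition (m n r : ℕ) (p : Finset (Finset (Fin r))) : Prop :=
  p.card = n ∧ (∀ B ∈ p, B.card = m) ∧ ∀ x : Fin r, ∃! B, B ∈ p ∧ x ∈ B

/-- The set partitions of `Fin r` into `n` sets, each of size `m`. -/
abbrev SetPartition (m n r : ℕ) : Type := {p : Finset (Finset (Fin r)) // IsSetPartition m n r p}

theorem IsSetPartition.image {m n r : ℕ} {p : Finset (Finset (Fin r))}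
    (hp : IsSetPartition m n r p) (σ : Equiv.Perm (Fin r)) :
    IsSetPartition m n r (p.image (fun B => B.image σ)) := by
  have hinj : Function.Injective (fun B : Finset (Fin r) => B.image σ) :=
    Finset.image_injective σ.injective
  refine ⟨?_, ?_, ?_⟩
  · rw [Finset.card_image_of_injective _ hinj, hp.1]
  · intro B hB
    obtain ⟨A, hA, rfl⟩ := Finset.mem_image.1 hB
    rw [Finset.card_image_of_injective _ σ.injective, hp.2.1 A hA]
  · intro x
    obtain ⟨A, ⟨hA, hx⟩, hu⟩ := hp.2.2 (σ.symm x)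
    refine ⟨A.image σ, ⟨Finset.mem_image_of_mem _ hA,
      Finset.mem_image.2 ⟨_, hx, by simp⟩⟩, ?_⟩
    rintro B ⟨hB, hxB⟩
    obtain ⟨A', hA', rfl⟩ := Finset.mem_image.1 hB
    obtain ⟨y, hy, rfl⟩ := Finset.mem_image.1 hxB
    rw [hu A' ⟨hA', by simpa using hy⟩]

/-- Permutations act on set partitions elementwise. -/
instance setPartitionAction (m n r : ℕ) :
    MulAction (Equiv.Perm (Fin r)) (SetPartition m n r) where
  smul σ p := ⟨p.1.image (fun B => B.image σ), p.2.image σ⟩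
  one_smul p := by
    apply Subtype.ext
    change p.1.image (fun B => B.image (1 : Equiv.Perm (Fin r))) = p.1
    simp
  mul_smul σ τ p := by
    apply Subtype.ext
    change p.1.image (fun B => B.image (σ * τ)) =
      (p.1.image (fun B => B.image τ)).image (fun B => B.image σ)
    simp [Finset.image_image, Function.comp_def]

/-- The Foulkes module `H^{(m^n)}` for the integral group ring of the symmetric group of degree
`m * n`. -/
noncomputable abbrev foulkesRep (m n : ℕ) :
    Representation ℤ (Equiv.Perm (Fin (m * n))) (MonoidAlgebra ℤ (SetPartition m n (m * n))) :=
  Representation.ofMulAction ℤ (Equiv.Perm (Fin (m * n))) (SetPartition m n (m * n))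

/-! ### Characters -/

/-- Extension of scalars of an integral representation to `ℚ`. -/
noncomputable def rationalRep {G V : Type*} [Group G] [AddCommGroup V]
    (ρ : Representation ℤ G V) : Representation ℚ G (ℚ ⊗[ℤ] V) where
  toFun g := (ρ g).baseChange ℚ
  map_one' := by simp
  map_mul' g h := by simp [LinearMap.baseChange_mul]

/-- The Foulkes character. -/
noncomputable def foulkesChar (m n : ℕ) : Equiv.Perm (Fin (m * n)) → ℚ :=
  (rationalRep (foulkesRep m n)).character

/-- The character of the rational Specht module. -/
noncomputable def spechtChar (lam : YoungDiagram) (r : ℕ) : Equiv.Perm (Fin r) → ℚ :=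
  (rationalRep (spechtRep lam r)).character

/-- The inner product of (rational-valued) characters of a finite group. -/
noncomputable def charInner {G : Type*} [Group G] [Fintype G] (φ χ : G → ℚ) : ℚ :=
  (∑ g : G, φ g * χ g⁻¹) / (Fintype.card G : ℚ)

/-- For a partition `lam` of `r`: the irreducible character labelled by `lam` is a minimal
constituent of `π`. -/
def IsMinimalConstituent {r : ℕ} (π : Equiv.Perm (Fin r) → ℚ) (lam : YoungDiagram) : Prop :=
  1 ≤ charInner π (spechtChar lam r) ∧
    ∀ mu : YoungDiagram, mu.card = r → Dominates lam mu → mu ≠ lam →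
      charInner π (spechtChar mu r) = 0

/-! ### Indexed set partitions and the homomorphisms `f_P` -/

/-- The set `A(lam)` of symbols `i_j` with `j ≤ lam'_i`. The symbol with number `i` and index `j`
is represented by the box in row `j` and column `i`, its place in the tableau `t_lam`. -/
abbrev IndexedSymbol (lam : YoungDiagram) : Type := Box lam

/-- The number `i` of the symbol `i_j`. -/
def IndexedSymbol.number {lam : YoungDiagram} (s : IndexedSymbol lam) : ℕ := s.1.2

/-- The index `j` of the symbol `i_j`. -/
def IndexedSymbol.index {lam : YoungDiagram} (s : IndexedSymbol lam) : ℕ := s.1.1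

/-- The tableau `t_lam`, whose column `i` is `i_1, i_2, …` from top to bottom, once the symbols
are identified with `Fin r` by `ι`. -/
def canonicalTableau {lam : YoungDiagram} {r : ℕ} (ι : IndexedSymbol lam ≃ Fin r) :
    Tableau lam r := ι

/-- The index that is appended to the number `i` in the set `X ∈ P`: the smallest one that was not
appended to `i` in a lexicographically smaller set of `P`. Indices start at `0` and are used in
order, so this is the number of lexicographically smaller sets of `P` that contain `i`. -/
def appendedIndex (P : Finset (Finset ℕ)) (X : Finset ℕ) (i : ℕ) : ℕ :=
  (P.filter (fun Y => LexLT Y X ∧ i ∈ Y)).card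

/-- The set of symbols obtained from `X ∈ P` by appending indices, transported to `Fin r`. -/
def indexedBlock {lam : YoungDiagram} {r : ℕ} (ι : IndexedSymbol lam ≃ Fin r)
    (P : Finset (Finset ℕ)) (X : Finset ℕ) : Finset (Fin r) :=
  (Finset.univ.filter (fun s : IndexedSymbol lam =>
    s.number ∈ X ∧ s.index = appendedIndex P X s.number)).map ι.toEmbedding

theorem lexLT_trichotomy {X Y : Finset ℕ} (h : X ≠ Y) : LexLT X Y ∨ LexLT Y X := by
  rcases lt_trichotomy (X.sort) (Y.sort) with h1 | h1 | h1
  · exact Or.inl h1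
  · exact absurd (by rw [← Finset.sort_toFinset X (· ≤ ·), h1, Finset.sort_toFinset]) h
  · exact Or.inr h1

theorem appendedIndex_lt {P : Finset (Finset ℕ)} {X Y : Finset ℕ} {i : ℕ}
    (hX : X ∈ P) (hiX : i ∈ X) (h : LexLT X Y) : appendedIndex P X i < appendedIndex P Y i := by
  apply Finset.card_lt_card
  rw [Finset.ssubset_iff_of_subset]
  · exact ⟨X, by simp [hX, hiX, h], fun hh => lt_irrefl _ (Finset.mem_filter.1 hh).2.1⟩
  · intro Z hZ
    simp only [Finset.mem_filter] at hZ ⊢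
    exact ⟨hZ.1, lt_trans hZ.2.1 h, hZ.2.2⟩

theorem appendedIndex_lt_colLen {lam : YoungDiagram} {P : Finset (Finset ℕ)} (hP : HasType P lam)
    {X : Finset ℕ} {i : ℕ} (hX : X ∈ P) (hiX : i ∈ X) :
    appendedIndex P X i < lam.colLen i := by
  rw [← hP i]
  apply Finset.card_lt_card
  rw [Finset.ssubset_iff_of_subset]
  · exact ⟨X, by simp [hX, hiX], fun hh => lt_irrefl _ (Finset.mem_filter.1 hh).2.1⟩
  · intro Z hZ
    simp only [Finset.mem_filter] at hZ ⊢
    exact ⟨hZ.1, hZ.2.2⟩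

theorem appendedIndex_inj {P : Finset (Finset ℕ)} {X Y : Finset ℕ} {i : ℕ}
    (hX : X ∈ P) (hY : Y ∈ P) (hiX : i ∈ X) (hiY : i ∈ Y)
    (h : appendedIndex P X i = appendedIndex P Y i) : X = Y := by
  by_contra hne
  rcases lexLT_trichotomy hne with h1 | h1
  · exact absurd h (appendedIndex_lt hX hiX h1).ne
  · exact absurd h (appendedIndex_lt hY hiY h1).ne'

/-- Every index `j < lam'_i` is appended to `i` in some set of `P`. -/
theorem exists_appendedIndex {lam : YoungDiagram} {P : Finset (Finset ℕ)} (hP : HasType P lam)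
    {i j : ℕ} (hj : j < lam.colLen i) : ∃ X ∈ P, i ∈ X ∧ appendedIndex P X i = j := by
  have hsurj := Finset.surj_on_of_inj_on_of_card_le
    (s := P.filter (fun X => i ∈ X)) (t := Finset.range (lam.colLen i))
    (fun X _ => appendedIndex P X i)
    (fun X hX => Finset.mem_range.2 (appendedIndex_lt_colLen hP (Finset.mem_filter.1 hX).1
      (Finset.mem_filter.1 hX).2))
    (fun X Y hX hY h => appendedIndex_inj (Finset.mem_filter.1 hX).1 (Finset.mem_filter.1 hY).1
      (Finset.mem_filter.1 hX).2 (Finset.mem_filter.1 hY).2 h)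
    (by rw [hP i, Finset.card_range])
  obtain ⟨X, hX, h⟩ := hsurj j (Finset.mem_range.2 hj)
  exact ⟨X, (Finset.mem_filter.1 hX).1, (Finset.mem_filter.1 hX).2, h.symm⟩

theorem mem_indexedBlock {lam : YoungDiagram} {r : ℕ} {ι : IndexedSymbol lam ≃ Fin r}
    {P : Finset (Finset ℕ)} {X : Finset ℕ} {x : Fin r} :
    x ∈ indexedBlock ι P X ↔ (IndexedSymbol.number (ι.symm x)) ∈ X ∧
      IndexedSymbol.index (ι.symm x) = appendedIndex P X (IndexedSymbol.number (ι.symm x)) := by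
  simp [indexedBlock, Finset.mem_map_equiv]

theorem image_number_indexedBlock {lam : YoungDiagram} {r : ℕ} (ι : IndexedSymbol lam ≃ Fin r)
    {P : Finset (Finset ℕ)} (hP : HasType P lam) {X : Finset ℕ} (hX : X ∈ P) :
    (indexedBlock ι P X).image (fun x => IndexedSymbol.number (ι.symm x)) = X := by
  ext i
  simp only [Finset.mem_image, mem_indexedBlock]
  constructor
  · rintro ⟨x, hx, rfl⟩
    exact hx.1
  · intro hi
    have hmem : (appendedIndex P X i, i) ∈ lam.cells :=
      YoungDiagram.mem_cells _ |>.2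
        (YoungDiagram.mem_iff_lt_colLen.2 (appendedIndex_lt_colLen hP hX hi))
    refine ⟨ι ⟨_, hmem⟩, ?_⟩
    simp [IndexedSymbol.number, IndexedSymbol.index, hi]

theorem isSetPartition_indexed {m n r : ℕ} {lam : YoungDiagram} (ι : IndexedSymbol lam ≃ Fin r)
    {P : Finset (Finset ℕ)} (hP : IsSetFamily m n P) (hT : HasType P lam) :
    IsSetPartition m n r (P.image (indexedBlock ι P)) := by
  refine ⟨?_, ?_, ?_⟩
  · rw [Finset.card_image_of_injOn, hP.1]
    intro X hX Y hY h
    have h' := congrArg (Finset.image (fun x => IndexedSymbol.number (ι.symm x))) h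
    rwa [image_number_indexedBlock ι hT hX, image_number_indexedBlock ι hT hY] at h'
  · intro B hB
    obtain ⟨X, hX, rfl⟩ := Finset.mem_image.1 hB
    rw [← hP.2 X hX]
    conv_rhs => rw [← image_number_indexedBlock ι hT hX]
    rw [Finset.card_image_of_injOn]
    intro x hx y hy h
    have hx' := (mem_indexedBlock.1 hx).2
    have hy' := (mem_indexedBlock.1 hy).2
    simp only at h
    rw [h, ← hy'] at hx'
    exact ι.symm.injective (Subtype.ext (Prod.ext hx' h))
  · intro x
    have hx : IndexedSymbol.index (ι.symm x) < lam.colLen (IndexedSymbol.number (ι.symm x)) :=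
      YoungDiagram.mem_iff_lt_colLen.1 ((YoungDiagram.mem_cells _).1 (ι.symm x).2)
    obtain ⟨X, hX, hi, hj⟩ := exists_appendedIndex hT hx
    refine ⟨indexedBlock ι P X, ⟨Finset.mem_image_of_mem _ hX,
      mem_indexedBlock.2 ⟨hi, hj.symm⟩⟩, ?_⟩
    rintro B ⟨hB, hxB⟩
    obtain ⟨Y, hY, rfl⟩ := Finset.mem_image.1 hB
    have hxY := mem_indexedBlock.1 hxB
    rw [appendedIndex_inj hX hY hi hxY.1 (hj.trans hxY.2)]

/-- The indexed set partition associated to a set family of shape `(m^n)` and type `lam`. -/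
def indexedSetPartition {m n r : ℕ} {lam : YoungDiagram} (ι : IndexedSymbol lam ≃ Fin r)
    (P : FamilyOfType m n lam) : SetPartition m n r :=
  ⟨P.1.image (indexedBlock ι P.1), isSetPartition_indexed ι P.2.1 P.2.2⟩

/-- The `ℤ`-module of homomorphisms of integral representations from `S^lam` to `H^{(m^n)}`. -/
abbrev SpechtFoulkesHom (m n : ℕ) (lam : YoungDiagram) : Type :=
  (spechtRep lam (m * n)).IntertwiningMap (foulkesRep m n)

/-- The defining property of `f_P`: it is the homomorphism that sends the generator `e_t` of
`S^lam`, where `t = t_lam`, to `u b_t`, where `u` is the indexed set partition associated to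
`P`. -/
def IsFamilyHom {m n : ℕ} {lam : YoungDiagram} (ι : IndexedSymbol lam ≃ Fin (m * n))
    (P : FamilyOfType m n lam) (f : SpechtFoulkesHom m n lam) : Prop :=
  f (spechtGen (canonicalTableau ι)) =
    (foulkesRep m n).asAlgebraHom (columnSum (canonicalTableau ι))
      (MonoidAlgebra.single (indexedSetPartition ι P) 1)

end SetFamilies

open SetFamilies

set_option linter.unusedSectionVars false

/-! Colour the points and call a vector alternating if every colour-preserving permutation
multiplies it by its sign; anything of the form `u b_t` alternates for the columns of `t`. An
exchange element is the signed sum of the transpositions of a point `y` with the points of another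
colour `i`, together with the identity. It turns a vector alternating for `c` into one alternating
for `c` with `y` recoloured `i`.

The engine is a universal property, `exists_spechtHom`: in a permutation module, a vector `v` that
alternates for the columns of `t` and is killed by all exchanges into columns further left is the
image of `e_t` under a homomorphism from the Specht module. Such a `v` satisfies `B g v ∈ ℚv` for
the signed column sum `B` and every `g`. Applied to the pair `(v, e_t)`, this shows that `B` kills
every translate of `a v` whenever `a e_t = 0`. Positivity of the standard form then gives `a v = 0`.
No straightening basis of the Specht module is needed.

Minimality enters through `alternating_eq_zero_of_noConstituentBelow`. Moving a point to a class at
least as large lowers the shape in the dominance order, so the module has no nonzero alternating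
vector for a column colouring with one point moved to the left. This has two consequences. Every
vector alternating for the columns of `t_λ` comes from a homomorphism, so each `f_P` exists. A
family that is not closed would yield a nonzero alternating vector for a recoloured tableau, so all
families are closed.

Oddness of `m` enters once: exchanging two blocks with the same colours is then an odd permutation.
Hence alternating functions live on set partitions whose blocks have distinct colours and pairwise
distinct colour sets. On these the column stabilizer acts freely, with orbits indexed by the
families. Evaluation at the `u_P` is therefore injective and sends the `f_P` to unit vectors, over
`ℤ` for the basis and over `ℚ` for the multiplicity. -/

namespace SetFamilies

open Equiv MonoidAlgebra

/-! ### Alternating vectors, exchange elements and the saturated line. -/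

section Alternating

variable {k α β : Type*} [CommRing k] [Fintype α] [DecidableEq α]

/-- The sign of a permutation as a scalar. -/
def signScalar (k : Type*) [CommRing k] {α : Type*} [Fintype α] [DecidableEq α] (τ : Perm α) : k :=
  (((Perm.sign τ : ℤˣ) : ℤ) : k)

@[simp]
theorem signScalar_one : signScalar k (1 : Perm α) = 1 := by simp [signScalar]

theorem signScalar_mul (σ τ : Perm α) :
    signScalar k (σ * τ) = signScalar k σ * signScalar k τ := by simp [signScalar]

@[simp]
theorem signScalar_inv (σ : Perm α) : signScalar k σ⁻¹ = signScalar k σ := by simp [signScalar]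

theorem signScalar_mul_self (σ : Perm α) : signScalar k σ * signScalar k σ = 1 := by
  rw [signScalar, ← Int.cast_mul, Int.units_coe_mul_self, Int.cast_one]

theorem perm_inv_apply {α : Type*} (σ : Perm α) (x : α) : σ⁻¹ (σ x) = x := by simp

theorem perm_apply_inv {α : Type*} (σ : Perm α) (x : α) : σ (σ⁻¹ x) = x := by simp

theorem signScalar_swap {x y : α} (h : x ≠ y) : signScalar k (swap x y) = -1 := by
  simp [signScalar, Perm.sign_swap h]

/-- The permutations that preserve a colouring. -/
def colourGroup (c : α → β) : Subgroup (Perm α) where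
  carrier := {σ | ∀ x, c (σ x) = c x}
  one_mem' := fun _ => rfl
  mul_mem' := fun {a b} ha hb x => (ha (b x)).trans (hb x)
  inv_mem' := fun {a} ha x => by
    have h := ha (a⁻¹ x)
    rw [perm_apply_inv] at h
    exact h.symm

theorem swap_mem_colourGroup {c : α → β} {x y : α} (h : c x = c y) : swap x y ∈ colourGroup c := by
  intro z
  by_cases hx : z = x
  · subst hx; simp [h]
  by_cases hy : z = y
  · subst hy; simp [h]
  rw [swap_apply_of_ne_of_ne hx hy]

open Classical in
/-- The signed sum over the permutations that preserve a colouring. -/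
noncomputable def signedSum (k : Type*) [CommRing k] (c : α → β) : MonoidAlgebra k (Perm α) :=
  ∑ τ : Perm α with τ ∈ colourGroup c, single τ (signScalar k τ)

theorem single_mul_signedSum {c : α → β} {σ : Perm α} (hσ : σ ∈ colourGroup c) :
    single σ 1 * signedSum k c = signScalar k σ • signedSum k c := by
  classical
  simp only [signedSum, Finset.mul_sum, single_mul_single, Finset.smul_sum, smul_single, one_mul]
  refine Finset.sum_bij (fun τ _ => σ * τ) ?_ ?_ ?_ ?_
  · intro τ hτ
    simp only [Finset.mem_filter, Finset.mem_univ, true_and] at hτ ⊢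
    exact mul_mem hσ hτ
  · intro a _ b _ h
    simpa using h
  · intro b hb
    simp only [Finset.mem_filter, Finset.mem_univ, true_and] at hb
    exact ⟨σ⁻¹ * b, by simpa using mul_mem (inv_mem hσ) hb, by group⟩
  · intro τ _
    rw [signScalar_mul, smul_eq_mul, ← mul_assoc, signScalar_mul_self, one_mul]

theorem signedSum_mul_single {c : α → β} {σ : Perm α} (hσ : σ ∈ colourGroup c) :
    signedSum k c * single σ 1 = signScalar k σ • signedSum k c := by
  classical
  simp only [signedSum, Finset.sum_mul, single_mul_single, Finset.smul_sum, smul_single, mul_one]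
  refine Finset.sum_bij (fun τ _ => τ * σ) ?_ ?_ ?_ ?_
  · intro τ hτ
    simp only [Finset.mem_filter, Finset.mem_univ, true_and] at hτ ⊢
    exact mul_mem hτ hσ
  · intro a _ b _ h
    simpa using h
  · intro b hb
    simp only [Finset.mem_filter, Finset.mem_univ, true_and] at hb
    exact ⟨b * σ⁻¹, by simpa using mul_mem hb (inv_mem hσ), by group⟩
  · intro τ _
    rw [signScalar_mul, smul_eq_mul, mul_comm (signScalar k τ), ← mul_assoc, signScalar_mul_self,
      one_mul]

variable {V W : Type*} [AddCommGroup V] [Module k V] [AddCommGroup W] [Module k W]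
  (ρ : Representation k (Perm α) V) (σ : Representation k (Perm α) W)

/-- Colour-preserving permutations act on `v` by their sign. -/
def IsAlternating (c : α → β) (v : V) : Prop :=
  ∀ τ ∈ colourGroup c, ρ τ v = signScalar k τ • v

variable {ρ σ}

theorem IsAlternating.congr {γ : Type*} {c : α → β} {d : α → γ} {v : V}
    (h : IsAlternating ρ c v) (hcd : ∀ x y, d x = d y → c x = c y) : IsAlternating ρ d v :=
  fun τ hτ => h τ fun x => hcd _ _ (hτ x)

theorem asAlgebraHom_mul_apply (a b : MonoidAlgebra k (Perm α)) (v : V) :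
    ρ.asAlgebraHom (a * b) v = ρ.asAlgebraHom a (ρ.asAlgebraHom b v) := by
  rw [map_mul]; rfl

theorem isAlternating_signedSum (c : α → β) (v : V) :
    IsAlternating ρ c (ρ.asAlgebraHom (signedSum k c) v) := by
  intro τ hτ
  rw [← ρ.asAlgebraHom_single_one τ, ← asAlgebraHom_mul_apply, single_mul_signedSum hτ, map_smul]
  rfl

open Classical in
theorem asAlgebraHom_signedSum_apply (c : α → β) (v : V) :
    ρ.asAlgebraHom (signedSum k c) v =
      ∑ τ : Perm α with τ ∈ colourGroup c, signScalar k τ • ρ τ v := by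
  simp [signedSum, map_sum, LinearMap.sum_apply, Representation.asAlgebraHom_single]

theorem IsAlternating.signedSum_apply {c : α → β} {v : V} (h : IsAlternating ρ c v) :
    ρ.asAlgebraHom (signedSum k c) v = (Nat.card (colourGroup c) : k) • v := by
  classical
  rw [asAlgebraHom_signedSum_apply, Finset.sum_congr rfl (g := fun _ => v), Finset.sum_const,
    Nat.cast_smul_eq_nsmul]
  · congr 1
    rw [Nat.card_eq_fintype_card, Fintype.card_subtype]
  · intro τ hτ
    rw [h τ (Finset.mem_filter.1 hτ).2, smul_smul, signScalar_mul_self, one_smul]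

open Classical in
/-- The signed sum of the transpositions of `y` with the points of colour `i`, together with the
identity. -/
noncomputable def exchange (k : Type*) [CommRing k] (c : α → β) (i : β) (y : α) :
    MonoidAlgebra k (Perm α) :=
  ∑ x : α with c x = i ∨ x = y, single (swap x y) (signScalar k (swap x y))

open Classical in
theorem asAlgebraHom_exchange_apply (c : α → β) (i : β) (y : α) (v : V) :
    ρ.asAlgebraHom (exchange k c i y) v =
      ∑ x : α with c x = i ∨ x = y, signScalar k (swap x y) • ρ (swap x y) v := by
  simp [exchange, map_sum, LinearMap.sum_apply, Representation.asAlgebraHom_single]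

/-- Applying an exchange element recolours a point. -/
theorem IsAlternating.exchange {c : α → β} {v : V} (h : IsAlternating ρ c v) (i : β) (y : α) :
    IsAlternating ρ (Function.update c y i) (ρ.asAlgebraHom (exchange k c i y) v) := by
  classical
  intro τ hτ
  have hmem : ∀ x, (c x = i ∨ x = y) ↔ Function.update c y i x = i := by
    intro x
    by_cases hx : x = y
    · simp [hx]
    · simp [hx]
  simp only [asAlgebraHom_exchange_apply, map_sum, Finset.smul_sum, hmem]
  refine Finset.sum_bij (fun x _ => τ x) ?_ ?_ ?_ ?_
  · intro x hx
    simpa [hτ x] using hx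
  · intro a _ b _ h
    simpa using h
  · intro b hb
    refine ⟨τ⁻¹ b, ?_, by simp⟩
    simp only [Finset.mem_filter, Finset.mem_univ, true_and] at hb ⊢
    exact ((inv_mem hτ) b).trans hb
  · intro x hx
    simp only [Finset.mem_filter, Finset.mem_univ, true_and] at hx
    -- The transpositions `(x y)` are coset representatives for the stabilizer of `y` in the
    -- enlarged class, and `π` is the stabilizer part of `τ (x y)`. It fixes `y` and preserves the
    -- new colouring, hence also preserves the old one, so `h` applies to it.
    set π := swap (τ x) y * τ * swap x y with hπ
    have hyy : Function.update c y i y = i := by simp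
    have hπu : π ∈ colourGroup (Function.update c y i) :=
      mul_mem (mul_mem (swap_mem_colourGroup (by rw [hτ x, hx, hyy])) hτ)
        (swap_mem_colourGroup (by rw [hx, hyy]))
    have hπy : π y = y := by simp [hπ]
    have hπc : π ∈ colourGroup c := by
      intro z
      by_cases hz : z = y
      · rw [hz, hπy]
      · have hz' : π z ≠ y := fun h => hz (π.injective (h.trans hπy.symm))
        simpa [hz, hz'] using hπu z
    have hmul : τ * swap x y = swap (τ x) y * π := by
      simp [hπ, ← mul_assoc]
    have hτ' : signScalar k τ * signScalar k (swap x y) =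
        signScalar k (swap (τ x) y) * signScalar k π := by
      rw [← signScalar_mul, hmul, signScalar_mul]
    rw [map_smul, ← Module.End.mul_apply, ← map_mul, hmul, map_mul, Module.End.mul_apply,
      h π hπc, map_smul, smul_smul, smul_smul]
    congr 1
    have h1 : signScalar k π = signScalar k (swap (τ x) y) * (signScalar k τ *
        signScalar k (swap x y)) := by
      rw [hτ', ← mul_assoc, signScalar_mul_self, one_mul]
    rw [h1]
    linear_combination (signScalar k (swap (τ x) y) * signScalar k τ) *
      signScalar_mul_self (k := k) (swap x y)

variable (ρ) in
/-- All exchanges of a point with the points of a smaller colour vanish on `v`. -/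
def HasExchange [LT β] (c : α → β) (v : V) : Prop :=
  ∀ y i, i < c y → ρ.asAlgebraHom (exchange k c i y) v = 0

theorem asAlgebraHom_prod_apply (a : MonoidAlgebra k (Perm α)) (v : V) (w : W) :
    (ρ.prod σ).asAlgebraHom a (v, w) = (ρ.asAlgebraHom a v, σ.asAlgebraHom a w) := by
  induction a using MonoidAlgebra.induction_linear with
  | zero => simp only [map_zero, LinearMap.zero_apply]; rfl
  | add a b ha hb => simp [ha, hb]
  | single g r => simp [Representation.asAlgebraHom_single]

theorem IsAlternating.prod {c : α → β} {v : V} {w : W} (hv : IsAlternating ρ c v)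
    (hw : IsAlternating σ c w) : IsAlternating (ρ.prod σ) c (v, w) := by
  intro τ hτ
  simp [hv τ hτ, hw τ hτ]

theorem HasExchange.prod [LT β] {c : α → β} {v : V} {w : W} (hv : HasExchange ρ c v)
    (hw : HasExchange σ c w) : HasExchange (ρ.prod σ) c (v, w) := by
  intro y i hi
  rw [asAlgebraHom_prod_apply, hv y i hi, hw y i hi]; rfl

/-- The vectors with a nonzero multiple in the line spanned by `v`. -/
def saturatedLine (k : Type*) [CommRing k] [IsDomain k] {V : Type*} [AddCommGroup V] [Module k V]
    (v : V) : Submodule k V where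
  carrier := {w | ∃ N z : k, N ≠ 0 ∧ N • w = z • v}
  zero_mem' := ⟨1, 0, one_ne_zero, by simp⟩
  add_mem' := by
    rintro a b ⟨N, z, hN, h⟩ ⟨N', z', hN', h'⟩
    refine ⟨N * N', N' * z + N * z', mul_ne_zero hN hN', ?_⟩
    rw [smul_add, add_smul, mul_smul N' z, ← h, mul_smul N z', ← h', smul_smul, smul_smul,
      mul_comm N' N]
  smul_mem' := by
    rintro r a ⟨N, z, hN, h⟩
    exact ⟨N, r * z, hN, by rw [smul_comm, h, smul_smul]⟩

theorem mem_saturatedLine_of_smul [IsDomain k] {v w : V} {N : k} (hN : N ≠ 0)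
    (h : N • w ∈ saturatedLine k v) : w ∈ saturatedLine k v := by
  obtain ⟨M, z, hM, h⟩ := h
  exact ⟨M * N, z, mul_ne_zero hM hN, by rw [mul_smul, h]⟩

/-- Two distinct colourings with equal class sizes: a point `y` of the least colour `j` in dispute
has a larger colour for `d`, and all points with colour `j` for `d` have at least this colour. -/
theorem exists_least_disagreement {c d : α → ℕ} (g : Perm α) (hd : ∀ x, d (g x) = c x)
    (hne : c ≠ d) : ∃ y, c y < d y ∧ ∀ x, d x = c y → c y ≤ c x := by
  classical
  obtain ⟨y₀, hy₀⟩ := Function.ne_iff.1 hne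
  obtain ⟨y, hy, hmin⟩ := Finset.exists_min_image (Finset.univ.filter fun x => c x ≠ d x) c
    ⟨y₀, by simpa using hy₀⟩
  simp only [Finset.mem_filter, Finset.mem_univ, true_and] at hy hmin
  -- Below the least disputed colour each class of `c` lies in the class of `d`, and `g` makes the
  -- two sizes equal.
  have hlow : ∀ j < c y, (Finset.univ.filter fun x => c x = j) =
      Finset.univ.filter fun x => d x = j := by
    intro j hj
    apply Finset.eq_of_subset_of_card_le
    · intro x hx
      simp only [Finset.mem_filter, Finset.mem_univ, true_and] at hx ⊢
      by_contra h
      have := hmin x (by rw [hx]; exact fun h' => h h'.symm)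
      omega
    · refine Finset.card_le_card_of_injOn (fun x => g⁻¹ x) ?_ (g⁻¹).injective.injOn
      intro x hx
      have := hd (g⁻¹ x)
      rw [perm_apply_inv] at this
      simp only [Finset.coe_filter, Finset.mem_univ, true_and, Set.mem_ofPred_eq] at hx ⊢
      rw [← this, hx]
  have hlow' : ∀ x, d x < c y → c x = d x := by
    intro x hx
    have : x ∈ Finset.univ.filter fun z => c z = d x := by
      rw [hlow _ hx]; simp
    simpa using this
  refine ⟨y, ?_, ?_⟩
  · by_contra h
    exact hy (hlow' y (by omega))
  · intro x hx
    by_contra h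
    have := hmin x
    omega

/-- A rearrangement inequality: the gain is `(c x - c y) * (d y - d x)`. The correlation of `c` with
its translate drives the induction below. -/
theorem sum_mul_swap_lt {c d : α → ℕ} {x y : α} (hx : c y < c x) (hy : c y < d y)
    (hdx : d x = c y) :
    ∑ z, c z * d z < ∑ z, c z * d (swap x y z) := by
  have hxy : x ≠ y := fun h => by simp [h] at hx
  have hyx : y ∈ (Finset.univ : Finset α).erase x := by simp [hxy.symm]
  rw [← Finset.add_sum_erase _ _ (Finset.mem_univ x), ← Finset.add_sum_erase _ _ (Finset.mem_univ x),
    ← Finset.add_sum_erase _ _ hyx, ← Finset.add_sum_erase _ _ hyx]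
  have : ∑ z ∈ (Finset.univ.erase x).erase y, c z * d (swap x y z) =
      ∑ z ∈ (Finset.univ.erase x).erase y, c z * d z := by
    refine Finset.sum_congr rfl fun z hz => ?_
    simp only [Finset.mem_erase, Finset.mem_univ, and_true] at hz
    rw [swap_apply_of_ne_of_ne hz.2 hz.1]
  rw [this, swap_apply_left, swap_apply_right, hdx]
  nlinarith

/-- The translate `g v` satisfies the exchange relations for `d = c ∘ g⁻¹`. If `d ≠ c`, an exchange
at a least disagreement writes `g v` as a sum of vectors `(x y) g v`. After applying the signed sum,
those with `c x = c y` return the original vector negated and are moved to the left, with total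
coefficient `q + 1 ≠ 0`; the others have larger correlation with `c`. The process ends at `d = c`,
where `g v` is `± v`. -/
theorem signedSum_single_mem_saturatedLine [IsDomain k] [CharZero k] {c : α → ℕ} {v : V}
    (hv : IsAlternating ρ c v) (hE : HasExchange ρ c v) (g : Perm α) :
    ρ.asAlgebraHom (signedSum k c) (ρ g v) ∈ saturatedLine k v := by
  classical
  -- Each value of `c` is at most the sum of all of them, so this subtraction never truncates (`h3`
  -- below).
  obtain ⟨M, hM⟩ : ∃ M, M = (∑ x, c x) * (∑ x, c x) - ∑ x, c x * c (g⁻¹ x) := ⟨_, rfl⟩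
  induction M using Nat.strong_induction_on generalizing g with
  | _ M ih =>
  set d : α → ℕ := fun x => c (g⁻¹ x) with hd
  have hdg : ∀ x, d (g x) = c x := fun x => by simp [hd]
  by_cases hcd : c = d
  · have hg : g ∈ colourGroup c := fun x => by rw [← hdg x, ← hcd]
    rw [hv g hg, map_smul, hv.signedSum_apply]
    exact ⟨1, signScalar k g * (Nat.card (colourGroup c) : k), one_ne_zero, by
      rw [one_smul, mul_smul]⟩
  obtain ⟨y, hy, hle⟩ := exists_least_disagreement g hdg hcd
  set B := signedSum k c with hB
  set s := Finset.univ.filter fun x => d x = c y with hs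
  have hys : y ∉ s := by simp [hs, hy.ne']
  have hex : ρ g v = ∑ x ∈ s, ρ (swap x y * g) v := by
    have h0 := hE (g⁻¹ y) (c y) hy
    rw [asAlgebraHom_exchange_apply] at h0
    have h1 := congrArg (ρ g) h0
    rw [map_sum, map_zero] at h1
    have h2 : ∑ x ∈ insert y s, signScalar k (swap x y) • ρ (swap x y * g) v = 0 := by
      rw [← h1]
      symm
      refine Finset.sum_bij (fun x _ => g x) ?_ ?_ ?_ ?_
      · intro x hx
        simp only [Finset.mem_filter, Finset.mem_univ, true_and] at hx
        rcases hx with hx | hx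
        · simp [hs, hdg, hx]
        · simp [hx]
      · intro a _ b _ h
        simpa using h
      · intro b hb
        refine ⟨g⁻¹ b, ?_, by simp⟩
        rcases Finset.mem_insert.1 hb with hb | hb
        · simp [hb]
        · simp only [hs, Finset.mem_filter, Finset.mem_univ, true_and] at hb
          simp [hd] at hb
          simp [hb]
      · intro x _
        have hsw : swap (g x) y * g = g * swap x (g⁻¹ y) := by
          have := Equiv.mul_swap_eq_swap_mul g x (g⁻¹ y)
          rw [this, perm_apply_inv]
        have hsg : signScalar k (swap (g x) y) = signScalar k (swap x (g⁻¹ y)) := by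
          have := congrArg (signScalar k) hsw
          rw [signScalar_mul, signScalar_mul, mul_comm] at this
          have h3 := congrArg (signScalar k g * ·) this
          simpa only [← mul_assoc, signScalar_mul_self, one_mul] using h3
        rw [hsw, hsg, map_smul, map_mul, Module.End.mul_apply]
    rw [Finset.sum_insert hys, swap_self] at h2
    have h3 : ∑ x ∈ s, signScalar k (swap x y) • ρ (swap x y * g) v =
        -∑ x ∈ s, ρ (swap x y * g) v := by
      rw [← Finset.sum_neg_distrib]
      refine Finset.sum_congr rfl fun x hx => ?_
      have hxy : x ≠ y := by rintro rfl; exact hys hx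
      rw [signScalar_swap hxy, neg_one_smul]
    rw [h3] at h2
    have h4 : (signScalar k (Equiv.refl α) : k) = 1 := signScalar_one
    rw [h4, one_smul] at h2
    have h5 : (Equiv.refl α : Perm α) * g = g := one_mul g
    rw [h5] at h2
    exact add_neg_eq_zero.1 h2
  have hB1 : ∀ x ∈ s.filter (fun x => c x = c y), ρ.asAlgebraHom B (ρ (swap x y * g) v) =
      -ρ.asAlgebraHom B (ρ g v) := by
    intro x hx
    have hx' := Finset.mem_filter.1 hx
    have hxy : x ≠ y := by rintro rfl; exact hys hx'.1
    rw [map_mul, Module.End.mul_apply, ← ρ.asAlgebraHom_single_one (swap x y),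
      ← asAlgebraHom_mul_apply, signedSum_mul_single (swap_mem_colourGroup hx'.2),
      signScalar_swap hxy, map_smul, neg_one_smul]
    rfl
  have hB2 : ρ.asAlgebraHom B (ρ g v) = ∑ x ∈ s, ρ.asAlgebraHom B (ρ (swap x y * g) v) := by
    conv_lhs => rw [hex]
    rw [map_sum]
  rw [← Finset.sum_filter_add_sum_filter_not s (fun x => c x = c y), Finset.sum_congr rfl hB1,
    Finset.sum_const] at hB2
  set q := (s.filter fun x => c x = c y).card
  have hN : ((q : k) + 1) ≠ 0 := by exact_mod_cast Nat.succ_ne_zero q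
  apply mem_saturatedLine_of_smul hN
  have hB3 : ((q : k) + 1) • ρ.asAlgebraHom B (ρ g v) =
      ∑ x ∈ s with ¬ c x = c y, ρ.asAlgebraHom B (ρ (swap x y * g) v) := by
    rw [add_smul, one_smul, Nat.cast_smul_eq_nsmul]
    nth_rewrite 2 [hB2]
    rw [smul_neg]
    abel
  rw [hB3]
  refine Submodule.sum_mem _ fun x hx => ?_
  simp only [hs, Finset.mem_filter, Finset.mem_univ, true_and] at hx
  refine ih _ ?_ _ rfl
  have hlt : c y < c x := lt_of_le_of_ne (hle x hx.1) (Ne.symm hx.2)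
  have h1 := sum_mul_swap_lt hlt hy hx.1
  have h2 : ∀ z, c ((swap x y * g)⁻¹ z) = d (swap x y z) := by
    intro z; simp [hd, mul_inv_rev]
  have h3 : ∑ z, c z * d (swap x y z) ≤ (∑ x, c x) * (∑ x, c x) := by
    rw [Finset.sum_mul]
    refine Finset.sum_le_sum fun z _ => Nat.mul_le_mul_left _ ?_
    exact Finset.single_le_sum (f := c) (fun _ _ => Nat.zero_le _) (Finset.mem_univ _)
  simp only [h2]
  rw [hM]
  change _ - _ < _ - ∑ z, c z * d z
  omega

/-- A vector that alternates and satisfies the exchange relations for `c` spans, up to torsion, the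
alternating vectors of the cyclic module it generates. -/
theorem signedSum_mem_saturatedLine [IsDomain k] [CharZero k] {c : α → ℕ} {v : V}
    (hv : IsAlternating ρ c v) (hE : HasExchange ρ c v) (a : MonoidAlgebra k (Perm α)) :
    ρ.asAlgebraHom (signedSum k c) (ρ.asAlgebraHom a v) ∈ saturatedLine k v := by
  induction a using MonoidAlgebra.induction_linear with
  | zero => simp
  | add a b ha hb => simpa using add_mem ha hb
  | single g r =>
    simpa [Representation.asAlgebraHom_single] using
      Submodule.smul_mem _ r (signedSum_single_mem_saturatedLine hv hE g)

/-- Working with the pair in the direct sum forces the same scalars `N` and `z` for both vectors;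
this is what transfers relations from one to the other. -/
theorem exists_smul_signedSum_eq_smul [IsDomain k] [CharZero k] {c : α → ℕ} {v : V} {w : W}
    (hv : IsAlternating ρ c v) (hvE : HasExchange ρ c v) (hw : IsAlternating σ c w)
    (hwE : HasExchange σ c w) (a : MonoidAlgebra k (Perm α)) :
    ∃ N z : k, N ≠ 0 ∧ N • ρ.asAlgebraHom (signedSum k c) (ρ.asAlgebraHom a v) = z • v ∧
      N • σ.asAlgebraHom (signedSum k c) (σ.asAlgebraHom a w) = z • w := by
  obtain ⟨N, z, hN, h⟩ := signedSum_mem_saturatedLine (hv.prod hw) (hvE.prod hwE) a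
  simp only [asAlgebraHom_prod_apply] at h
  exact ⟨N, z, hN, congrArg Prod.fst h, congrArg Prod.snd h⟩

end Alternating

/-! ### Alternating functions and the invariant form on permutation modules. -/

section PermutationModules

variable {R α β X : Type*} [CommRing R] [Fintype α] [DecidableEq α] [MulAction (Perm α) X]

/-- Colour-preserving permutations act on the function `h` by their sign. -/
def IsAlternatingFun (c : α → β) (h : X → R) : Prop :=
  ∀ τ ∈ colourGroup c, ∀ p, h (τ • p) = signScalar R τ * h p

theorem IsAlternating.isAlternatingFun {c : α → β} {v : MonoidAlgebra R X}
    (hv : IsAlternating (Representation.ofMulAction R (Perm α) X) c v) :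
    IsAlternatingFun c v.coeff := by
  intro τ hτ p
  have h := congrArg (fun w : MonoidAlgebra R X => w.coeff p) (hv τ⁻¹ (inv_mem hτ))
  simpa [Representation.coeff_ofMulAction] using h

theorem IsAlternatingFun.eq_zero [IsDomain R] [CharZero R] {c : α → β} {h : X → R}
    (hh : IsAlternatingFun c h) {τ : Perm α} (hτ : τ ∈ colourGroup c)
    (hs : Perm.sign τ = -1) {p : X} (hp : τ • p = p) : h p = 0 := by
  have h1 := hh τ hτ p
  rw [hp, signScalar, hs] at h1
  simp only [Units.val_neg, Units.val_one, Int.cast_neg, Int.cast_one, neg_mul, one_mul] at h1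
  exact self_eq_neg.1 h1

theorem IsAlternatingFun.smul_ne_zero [IsDomain R] {c : α → β} {h : X → R}
    (hh : IsAlternatingFun c h) {τ : Perm α} (hτ : τ ∈ colourGroup c) {p : X} (hp : h p ≠ 0) :
    h (τ • p) ≠ 0 := by
  rw [hh τ hτ p]
  refine mul_ne_zero (fun h0 => ?_) hp
  have := signScalar_mul_self (k := R) τ
  simp [h0] at this

open Classical in
theorem coeff_signedSum_single (c : α → β) (p q : X) :
    ((Representation.ofMulAction R (Perm α) X).asAlgebraHom (signedSum R c)
      (single p 1)).coeff q =
      ∑ τ : Perm α with τ ∈ colourGroup c ∧ τ • p = q, signScalar R τ := by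
  rw [asAlgebraHom_signedSum_apply, coeff_sum, Finsupp.finsetSum_apply, ← Finset.filter_filter,
    Finset.sum_filter (fun τ => τ • p = q)]
  refine Finset.sum_congr rfl fun τ _ => ?_
  simp [Finsupp.single_apply]

theorem coeff_signedSum_single_self {c : α → β} {p : X}
    (hp : ∀ τ ∈ colourGroup c, τ • p = p → τ = 1) :
    ((Representation.ofMulAction R (Perm α) X).asAlgebraHom (signedSum R c)
      (single p 1)).coeff p = 1 := by
  classical
  rw [coeff_signedSum_single, Finset.sum_eq_single_of_mem 1]
  · simp
  · simp
  · intro τ hτ h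
    simp only [Finset.mem_filter, Finset.mem_univ, true_and] at hτ
    exact absurd (hp τ hτ.1 hτ.2) h

theorem exists_of_coeff_signedSum_single_ne_zero {c : α → β} {p q : X}
    (h : ((Representation.ofMulAction R (Perm α) X).asAlgebraHom (signedSum R c)
      (single p 1)).coeff q ≠ 0) : ∃ τ ∈ colourGroup c, τ • p = q := by
  classical
  rw [coeff_signedSum_single] at h
  obtain ⟨τ, hτ, -⟩ := Finset.exists_ne_zero_of_sum_ne_zero h
  exact ⟨τ, by simpa using hτ⟩

variable (X) in
/-- The symmetric bilinear form for which the points of `X` are orthonormal. -/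
noncomputable def coeffForm [Fintype X] :
    MonoidAlgebra ℤ X →ₗ[ℤ] MonoidAlgebra ℤ X →ₗ[ℤ] ℤ :=
  LinearMap.mk₂ ℤ (fun f g => ∑ x, f.coeff x * g.coeff x)
    (by intros; simp [add_mul, Finset.sum_add_distrib])
    (by intros; simp [mul_assoc, Finset.mul_sum])
    (by intros; simp [mul_add, Finset.sum_add_distrib])
    (by intros; simp [mul_left_comm, Finset.mul_sum])

theorem coeffForm_apply [Fintype X] (f g : MonoidAlgebra ℤ X) :
    coeffForm X f g = ∑ x, f.coeff x * g.coeff x := rfl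

theorem coeffForm_self_eq_zero [Fintype X] {f : MonoidAlgebra ℤ X} (h : coeffForm X f f = 0) :
    f = 0 := by
  rw [coeffForm_apply, Finset.sum_eq_zero_iff_of_nonneg fun _ _ => mul_self_nonneg _] at h
  ext x
  simpa using h x (Finset.mem_univ x)

theorem coeffForm_smul_left [Fintype X] (g : Perm α) (f f' : MonoidAlgebra ℤ X) :
    coeffForm X (Representation.ofMulAction ℤ (Perm α) X g f) f' =
      coeffForm X f (Representation.ofMulAction ℤ (Perm α) X g⁻¹ f') := by
  simp only [coeffForm_apply, Representation.coeff_ofMulAction, inv_inv]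
  refine Fintype.sum_equiv (MulAction.toPerm g⁻¹) _ _ fun x => ?_
  simp

/-- The form is invariant, and inversion permutes the signed terms of the sum without changing
signs. -/
theorem coeffForm_signedSum_left [Fintype X] (c : α → β) (f f' : MonoidAlgebra ℤ X) :
    coeffForm X ((Representation.ofMulAction ℤ (Perm α) X).asAlgebraHom (signedSum ℤ c) f) f' =
      coeffForm X f ((Representation.ofMulAction ℤ (Perm α) X).asAlgebraHom (signedSum ℤ c) f') := by
  classical
  simp only [asAlgebraHom_signedSum_apply, map_sum, LinearMap.sum_apply, map_smul,
    LinearMap.smul_apply, coeffForm_smul_left]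
  refine Finset.sum_bij (fun τ _ => τ⁻¹) ?_ ?_ ?_ ?_
  · intro τ hτ
    simp only [Finset.mem_filter, Finset.mem_univ, true_and] at hτ ⊢
    exact inv_mem hτ
  · intro a _ b _ h
    exact inv_injective h
  · intro b hb
    simp only [Finset.mem_filter, Finset.mem_univ, true_and] at hb
    exact ⟨b⁻¹, by simpa using inv_mem hb, inv_inv b⟩
  · intro τ _
    simp

/-- If `v` and `e ≠ 0` both alternate and satisfy the exchange relations for `c`, then `v`
satisfies all relations that `e` satisfies. -/
theorem asAlgebraHom_eq_zero_of_exchange [Finite X] {W : Type*} [AddCommGroup W] [Module ℤ W]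
    [Module.IsTorsionFree ℤ W] {σ : Representation ℤ (Perm α) W} {c : α → ℕ}
    {v : MonoidAlgebra ℤ X} {e : W}
    (hv : IsAlternating (Representation.ofMulAction ℤ (Perm α) X) c v)
    (hvE : HasExchange (Representation.ofMulAction ℤ (Perm α) X) c v)
    (he : IsAlternating σ c e) (heE : HasExchange σ c e) (he0 : e ≠ 0)
    {a : MonoidAlgebra ℤ (Perm α)} (ha : σ.asAlgebraHom a e = 0) :
    (Representation.ofMulAction ℤ (Perm α) X).asAlgebraHom a v = 0 := by
  have := Fintype.ofFinite X
  set ρ := Representation.ofMulAction ℤ (Perm α) X with hρ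
  set w := ρ.asAlgebraHom a v with hw
  -- The common scalar `z` satisfies `z e = 0`, so it vanishes and the corresponding vector on the
  -- side of `v` is torsion.
  have hkill : ∀ g, ρ.asAlgebraHom (signedSum ℤ c) (ρ g w) = 0 := by
    intro g
    obtain ⟨N, z, hN, h1, h2⟩ := exists_smul_signedSum_eq_smul hv hvE he heE (single g 1 * a)
    simp only [asAlgebraHom_mul_apply, ha, map_zero, Representation.asAlgebraHom_single_one,
      smul_zero] at h1 h2
    have hz : z = 0 := (smul_eq_zero.1 h2.symm).resolve_right he0
    rw [hz, zero_smul] at h1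
    exact (smul_eq_zero.1 h1).resolve_left hN
  -- Up to the order of the colour group, `v` is its own signed sum; by adjointness that sum moves
  -- onto a translate of `w`, which it kills. As `w = a v` lies in the span of the `g v`, it is
  -- orthogonal to itself.
  have horth : ∀ g, coeffForm X w (ρ g v) = 0 := by
    intro g
    have hcard : (Nat.card (colourGroup c) : ℤ) ≠ 0 := by
      exact_mod_cast Nat.card_pos.ne'
    have h1 : coeffForm X w (ρ g (ρ.asAlgebraHom (signedSum ℤ c) v)) = 0 := by
      have h2 := coeffForm_smul_left g⁻¹ w (ρ.asAlgebraHom (signedSum ℤ c) v)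
      rw [inv_inv] at h2
      rw [← h2, ← coeffForm_signedSum_left, ← hρ, hkill, map_zero, LinearMap.zero_apply]
    rw [hv.signedSum_apply, map_smul, map_smul] at h1
    exact (smul_eq_zero.1 h1).resolve_left hcard
  apply coeffForm_self_eq_zero
  have hall : ∀ b : MonoidAlgebra ℤ (Perm α), coeffForm X w (ρ.asAlgebraHom b v) = 0 := by
    intro b
    induction b using MonoidAlgebra.induction_linear with
    | zero => simp
    | add a b ha hb => simp [ha, hb]
    | single g r => simp [Representation.asAlgebraHom_single, horth]
  exact hall a

end PermutationModules

/-! ### Homomorphisms out of cyclic representations. -/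

theorem exists_intertwiningMap {k G V W : Type*} [CommRing k] [Group G] [AddCommGroup V]
    [Module k V] [AddCommGroup W] [Module k W] (σ : Representation k G W)
    (ρ : Representation k G V) {e : W} {v : V} (hsurj : ∀ w, ∃ a, σ.asAlgebraHom a e = w)
    (hker : ∀ a, σ.asAlgebraHom a e = 0 → ρ.asAlgebraHom a v = 0) :
    ∃ f : σ.IntertwiningMap ρ, f e = v := by
  choose a ha using hsurj
  have hwd : ∀ b b', σ.asAlgebraHom b e = σ.asAlgebraHom b' e →
      ρ.asAlgebraHom b v = ρ.asAlgebraHom b' v := by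
    intro b b' h
    have := hker (b - b') (by simp [h])
    simpa [sub_eq_zero] using this
  let f : W →ₗ[k] V :=
    { toFun := fun w => ρ.asAlgebraHom (a w) v
      map_add' := fun w w' => by
        have := hwd (a (w + w')) (a w + a w') (by simp [ha])
        simpa using this
      map_smul' := fun r w => by
        have := hwd (a (r • w)) (r • a w) (by simp [ha])
        simpa using this }
  refine ⟨⟨f, fun g => ?_⟩, ?_⟩
  · ext w
    have := hwd (a (σ g w)) (single g 1 * a w) (by simp [ha])
    simpa [f] using this
  · have := hwd (a e) 1 (by simp [ha])
    simpa [f] using this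

theorem intertwiningMap_asAlgebraHom {k G V W : Type*} [CommRing k] [Group G] [AddCommGroup V]
    [Module k V] [AddCommGroup W] [Module k W] {σ : Representation k G W}
    {ρ : Representation k G V} (f : σ.IntertwiningMap ρ) (a : MonoidAlgebra k G) (w : W) :
    f (σ.asAlgebraHom a w) = ρ.asAlgebraHom a (f w) := by
  induction a using MonoidAlgebra.induction_linear with
  | zero => simp
  | add a b ha hb => simp [ha, hb]
  | single g z => simp [Representation.asAlgebraHom_single, f.isIntertwining]

/-! ### Polytabloids and the universal property of the Specht module. -/

section Specht

variable {lam : YoungDiagram} {r : ℕ}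

theorem columnSum_eq_signedSum (t : Tableau lam r) : columnSum t = signedSum ℤ t.colOf := by
  simp only [columnSum, signedSum, signScalar, Int.cast_id]
  rfl

theorem Tableau.rowOf_lt_colLen (t : Tableau lam r) (x : Fin r) :
    t.rowOf x < lam.colLen (t.colOf x) :=
  YoungDiagram.mem_iff_lt_colLen.1 ((YoungDiagram.mem_cells _).1 (t.symm x).2)

theorem Tableau.card_colOf_eq (t : Tableau lam r) (j : ℕ) :
    (Finset.univ.filter fun x => t.colOf x = j).card = lam.colLen j := by
  rw [YoungDiagram.colLen_eq_card]
  refine Finset.card_bij (fun x _ => (t.symm x).1) ?_ ?_ ?_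
  · intro x hx
    simp only [Finset.mem_filter, Finset.mem_univ, true_and] at hx
    exact YoungDiagram.mem_col_iff.2 ⟨(YoungDiagram.mem_cells _).1 (t.symm x).2, hx⟩
  · intro x _ y _ h
    exact t.symm.injective (Subtype.ext h)
  · intro b hb
    obtain ⟨hb, hj⟩ := YoungDiagram.mem_col_iff.1 hb
    exact ⟨t ⟨b, (YoungDiagram.mem_cells _).2 hb⟩, by simp [Tableau.colOf, ← hj], by simp⟩

/-- The row of a tabloid that contains the entry `x`. -/
def Tabloid.rowOf (T : Tabloid lam r) (x : Fin r) : ℕ :=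
  Quotient.lift (fun t : Tableau lam r => t.rowOf x) (fun a b h => (show ∀ y, a.rowOf y = b.rowOf y from h) x) T

theorem Tabloid.rowOf_smul (σ : Perm (Fin r)) (T : Tabloid lam r) (x : Fin r) :
    Tabloid.rowOf (σ • T) x = Tabloid.rowOf T (σ⁻¹ x) := by
  induction T using Quotient.inductionOn with | _ t => rfl

theorem Tabloid.ext_rowOf {S T : Tabloid lam r} (h : ∀ x, S.rowOf x = T.rowOf x) : S = T := by
  induction S using Quotient.inductionOn with | _ s =>
  induction T using Quotient.inductionOn with | _ t =>
  exact Quotient.sound (show ∀ x, s.rowOf x = t.rowOf x from h)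

theorem Tabloid.swap_smul {T : Tabloid lam r} {x y : Fin r} (h : T.rowOf x = T.rowOf y) :
    swap x y • T = T := by
  refine Tabloid.ext_rowOf fun z => ?_
  rw [Tabloid.rowOf_smul, swap_inv]
  by_cases hx : z = x
  · subst hx; simp [h]
  by_cases hy : z = y
  · subst hy; simp [h]
  rw [swap_apply_of_ne_of_ne hx hy]

theorem polytabloid_eq (t : Tableau lam r) :
    polytabloid t = (youngRep lam r).asAlgebraHom (signedSum ℤ t.colOf) (single t.tabloid 1) := by
  rw [polytabloid, columnSum_eq_signedSum]

theorem isAlternating_polytabloid (t : Tableau lam r) :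
    IsAlternating (youngRep lam r) t.colOf (polytabloid t) := by
  rw [polytabloid_eq]
  exact isAlternating_signedSum _ _

theorem polytabloid_ne_zero (t : Tableau lam r) : polytabloid t ≠ 0 := by
  intro h
  have h1 : (polytabloid t).coeff t.tabloid = 1 := by
    rw [polytabloid_eq]
    refine coeff_signedSum_single_self fun τ hτ hfix => ?_
    ext x : 1
    apply t.symm.injective
    have hrow : t.rowOf (τ x) = t.rowOf x := by
      have := Tabloid.rowOf_smul τ t.tabloid (τ x)
      rw [hfix, perm_inv_apply] at this
      exact this
    exact Subtype.ext (Prod.ext hrow (hτ x))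
  simp [h] at h1

/-- A pigeonhole form of the Garnir relations. The exchanged vector alternates for a class of
`colLen i + 1` points, so in any tabloid of its support these lie in distinct rows. All these rows
have number below `colLen i`, which is impossible. -/
theorem hasExchange_polytabloid (t : Tableau lam r) :
    HasExchange (youngRep lam r) t.colOf (polytabloid t) := by
  classical
  intro y i hi
  set w := (youngRep lam r).asAlgebraHom (exchange ℤ t.colOf i y) (polytabloid t) with hw
  have halt := ((isAlternating_polytabloid t).exchange i y).isAlternatingFun
  rw [← hw] at halt
  ext T
  by_contra hT
  change w.coeff T ≠ 0 at hT
  set c := Function.update t.colOf y i with hc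
  have hmem : ∀ x, c x = i ↔ (t.colOf x = i ∨ x = y) := by
    intro x
    by_cases hx : x = y <;> simp [hc, hx]
  have hinj : ∀ x x', c x = i → c x' = i → T.rowOf x = T.rowOf x' → x = x' := by
    intro x x' hx hx' hrow
    by_contra hne
    exact hT (halt.eq_zero (swap_mem_colourGroup (hx.trans hx'.symm)) (Perm.sign_swap hne)
      (Tabloid.swap_smul hrow))
  have hlt : ∀ z, c z = i → T.rowOf z < lam.colLen i := by
    rw [hw, asAlgebraHom_exchange_apply, coeff_sum, Finsupp.finsetSum_apply] at hT
    obtain ⟨x, hx, hne⟩ := Finset.exists_ne_zero_of_sum_ne_zero hT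
    simp only [Finset.mem_filter, Finset.mem_univ, true_and, ← hmem] at hx
    have hS : (polytabloid t).coeff ((swap x y)⁻¹ • T) ≠ 0 := by
      intro h0
      apply hne
      rw [coeff_smul_apply, Representation.coeff_ofMulAction, h0, smul_zero]
    rw [polytabloid_eq] at hS
    obtain ⟨τ, hτ, hτT⟩ := exists_of_coeff_signedSum_single_ne_zero hS
    intro z hz
    have hTz : T.rowOf z = t.rowOf (τ⁻¹ (swap x y z)) := by
      have h1 : T = swap x y • τ • t.tabloid := by rw [hτT, smul_inv_smul]
      rw [h1, Tabloid.rowOf_smul, Tabloid.rowOf_smul, swap_inv]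
      rfl
    have hsw : c (swap x y z) = i := by
      rw [swap_mem_colourGroup (c := c) (by rw [hx]; simp [hc]) z, hz]
    -- Before the exchange a point of the enlarged class lies in column `i` or is `y` itself, whose
    -- column is further right and therefore no longer.
    have hcol : i ≤ t.colOf (swap x y z) := by
      rcases (hmem _).1 hsw with h | h
      · exact h.ge
      · rw [h]; exact hi.le
    rw [hTz]
    refine lt_of_lt_of_le (t.rowOf_lt_colLen _) ?_
    rw [inv_mem hτ]
    exact lam.colLen_anti _ _ hcol
  have hcard : (Finset.univ.filter fun z => c z = i).card = lam.colLen i + 1 := by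
    have : (Finset.univ.filter fun z => c z = i) =
        insert y (Finset.univ.filter fun z => t.colOf z = i) := by
      ext z
      simp [hmem, or_comm]
    rw [this, Finset.card_insert_of_notMem (by simpa using hi.ne'), t.card_colOf_eq]
  have := Finset.card_le_card_of_injOn (s := Finset.univ.filter fun z => c z = i)
    (t := Finset.range (lam.colLen i)) (fun z => T.rowOf z)
    (fun z hz => by simpa using hlt z (by simpa using hz))
    (fun z hz z' hz' h => hinj z z' (by simpa using hz) (by simpa using hz') h)
  rw [hcard, Finset.card_range] at this
  omega

theorem coe_asAlgebraHom_spechtRep (a : MonoidAlgebra ℤ (Perm (Fin r)))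
    (x : spechtModule lam r) :
    ((spechtRep lam r).asAlgebraHom a x : MonoidAlgebra ℤ (Tabloid lam r)) =
      (youngRep lam r).asAlgebraHom a x := by
  induction a using MonoidAlgebra.induction_linear with
  | zero => simp
  | add a b ha hb => simp [ha, hb]
  | single g z =>
    simp only [Representation.asAlgebraHom_single, LinearMap.smul_apply, Submodule.coe_smul]
    rfl

theorem spechtGen_generates (t : Tableau lam r) (w : spechtModule lam r) :
    ∃ a, (spechtRep lam r).asAlgebraHom a (spechtGen t) = w := by
  obtain ⟨w, hw⟩ := w
  suffices h : ∃ a, (youngRep lam r).asAlgebraHom a (polytabloid t) = w by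
    obtain ⟨a, ha⟩ := h
    exact ⟨a, Subtype.ext (by rw [coe_asAlgebraHom_spechtRep]; exact ha)⟩
  induction hw using Submodule.span_induction with
  | mem x hx =>
    obtain ⟨s, rfl⟩ := hx
    refine ⟨single (t.symm.trans s) 1, ?_⟩
    rw [Representation.asAlgebraHom_single_one, perm_polytabloid, ← Equiv.trans_assoc,
      Equiv.self_trans_symm, Equiv.refl_trans]
  | zero => exact ⟨0, by simp⟩
  | add x y _ _ hx hy =>
    obtain ⟨a, ha⟩ := hx
    obtain ⟨b, hb⟩ := hy
    exact ⟨a + b, by simp [ha, hb]⟩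
  | smul z x _ hx =>
    obtain ⟨a, ha⟩ := hx
    exact ⟨z • a, by simp [ha]⟩

/-- A vector of a permutation module that alternates and satisfies the exchange relations for the
columns of `t` is the image of `e_t` under a homomorphism. -/
theorem exists_spechtHom {X : Type*} [Finite X] [MulAction (Perm (Fin r)) X] (t : Tableau lam r)
    {v : MonoidAlgebra ℤ X}
    (hv : IsAlternating (Representation.ofMulAction ℤ (Perm (Fin r)) X) t.colOf v)
    (hvE : HasExchange (Representation.ofMulAction ℤ (Perm (Fin r)) X) t.colOf v) :
    ∃ f : (spechtRep lam r).IntertwiningMap (Representation.ofMulAction ℤ (Perm (Fin r)) X),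
      f (spechtGen t) = v := by
  refine exists_intertwiningMap _ _ (spechtGen_generates t) fun a ha => ?_
  refine asAlgebraHom_eq_zero_of_exchange hv hvE (isAlternating_polytabloid t)
    (hasExchange_polytabloid t) (polytabloid_ne_zero t) ?_
  have := congrArg Subtype.val ha
  rw [coe_asAlgebraHom_spechtRep] at this
  exact this

theorem intertwiningMap_ext_spechtGen {V : Type*} [AddCommGroup V] [Module ℤ V]
    {ρ : Representation ℤ (Perm (Fin r)) V} (t : Tableau lam r)
    {f f' : (spechtRep lam r).IntertwiningMap ρ} (h : f (spechtGen t) = f' (spechtGen t)) :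
    f = f' := by
  apply Representation.IntertwiningMap.ext
  ext w : 1
  obtain ⟨a, rfl⟩ := spechtGen_generates t w
  change f _ = f' _
  rw [intertwiningMap_asAlgebraHom, intertwiningMap_asAlgebraHom, h]

end Specht

/-! ### Dominance in terms of column lengths, and shapes of colourings. -/

section Diagrams

variable {lam mu : YoungDiagram} {r : ℕ}

theorem column_lt_card {p : ℕ × ℕ} (hp : p ∈ lam) : p.2 < lam.card := by
  have h0 : (0, p.2) ∈ lam := lam.up_left_mem (Nat.zero_le _) le_rfl hp
  refine lt_of_lt_of_le (YoungDiagram.mem_iff_lt_rowLen.1 h0) ?_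
  rw [YoungDiagram.rowLen_eq_card]
  exact Finset.card_le_card (Finset.filter_subset _ _)

theorem Tableau.card_eq (t : Tableau lam r) : lam.card = r := by
  have := Fintype.card_congr t
  rw [Fintype.card_fin, Fintype.card_coe] at this
  exact this

theorem Tableau.colOf_lt (t : Tableau lam r) (x : Fin r) : t.colOf x < r := by
  have := column_lt_card ((YoungDiagram.mem_cells _).1 (t.symm x).2)
  rwa [t.card_eq] at this

/-- The cells in the first `k` rows, and those below, column by column. -/
theorem sum_rowLen_add_sum_colLen_sub (hr : lam.card = r) (k : ℕ) :
    ∑ i ∈ Finset.range k, lam.rowLen i + ∑ j ∈ Finset.range r, (lam.colLen j - k) = r := by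
  have h1 : (lam.cells.filter fun p => p.1 < k).card = ∑ i ∈ Finset.range k, lam.rowLen i := by
    rw [Finset.card_eq_sum_card_fiberwise (f := Prod.fst) (t := Finset.range k)
      (fun p hp => by simpa using (Finset.mem_filter.1 hp).2)]
    refine Finset.sum_congr rfl fun i hi => ?_
    rw [YoungDiagram.rowLen_eq_card, YoungDiagram.row, Finset.filter_filter]
    congr 1
    refine Finset.filter_congr fun p _ => ?_
    have := Finset.mem_range.1 hi
    constructor
    · exact fun h => h.2
    · rintro rfl; exact ⟨this, rfl⟩
  have h2 : (lam.cells.filter fun p => ¬ p.1 < k).card =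
      ∑ j ∈ Finset.range r, (lam.colLen j - k) := by
    rw [Finset.card_eq_sum_card_fiberwise (f := Prod.snd) (t := Finset.range r)
      (fun p hp => by
        have := column_lt_card ((YoungDiagram.mem_cells _).1 (Finset.mem_filter.1 hp).1)
        simpa [hr] using this)]
    refine Finset.sum_congr rfl fun j _ => ?_
    rw [← Nat.card_Ico, ← Finset.card_map ⟨fun i : ℕ => (i, j), fun _ _ h => (Prod.ext_iff.1 h).1⟩]
    congr 1
    ext ⟨a, b⟩
    simp only [Finset.mem_filter, YoungDiagram.mem_cells, YoungDiagram.mem_iff_lt_colLen,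
      Finset.mem_map, Finset.mem_Ico]
    constructor
    · rintro ⟨⟨h, h'⟩, rfl⟩
      exact ⟨a, ⟨by omega, h⟩, rfl⟩
    · rintro ⟨i, ⟨h, h'⟩, heq⟩
      obtain ⟨rfl, rfl⟩ := Prod.mk.inj (show (i, j) = (a, b) from heq)
      exact ⟨⟨h', by omega⟩, rfl⟩
  rw [← h1, ← h2, Finset.card_filter_add_card_filter_not]
  exact hr

/-- The truncated sums count the cells below row `k`. They do not depend on the order of the
columns, so they also make sense for unsorted class sizes. -/
theorem dominates_of_sum_colLen_sub_le (hlam : lam.card = r) (hmu : mu.card = r)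
    (h : ∀ k, ∑ j ∈ Finset.range r, (lam.colLen j - k) ≤
      ∑ j ∈ Finset.range r, (mu.colLen j - k)) : Dominates lam mu := by
  intro k
  have h1 := sum_rowLen_add_sum_colLen_sub hlam k
  have h2 := sum_rowLen_add_sum_colLen_sub hmu k
  have := h k
  omega

/-- The number of points of colour `j`. -/
def classSize {β : Type*} [DecidableEq β] (c : Fin r → β) (j : β) : ℕ :=
  (Finset.univ.filter fun x => c x = j).card

theorem Tableau.classSize_colOf (t : Tableau lam r) (j : ℕ) :
    classSize t.colOf j = lam.colLen j := t.card_colOf_eq j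

theorem classSize_le (c : Fin r → ℕ) (j : ℕ) : classSize c j ≤ r :=
  (Finset.card_le_univ _).trans (by simp)

theorem classSize_update_self {c : Fin r → ℕ} {y : Fin r} {i : ℕ} (h : c y ≠ i) :
    classSize (Function.update c y i) i = classSize c i + 1 := by
  rw [classSize, classSize, ← Finset.card_insert_of_notMem (a := y) (by simpa using h)]
  congr 1
  ext x
  by_cases hx : x = y <;> simp [hx]

theorem classSize_update_old {c : Fin r → ℕ} {y : Fin r} {i : ℕ} (h : c y ≠ i) :
    classSize (Function.update c y i) (c y) + 1 = classSize c (c y) := by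
  rw [classSize, classSize, ← Finset.card_insert_of_notMem (a := y) (by simpa using h.symm)]
  congr 1
  ext x
  by_cases hx : x = y <;> simp [hx]

theorem classSize_update_of_ne {c : Fin r → ℕ} {y : Fin r} {i j : ℕ} (hi : j ≠ i)
    (hj : j ≠ c y) : classSize (Function.update c y i) j = classSize c j := by
  rw [classSize, classSize]
  congr 1
  ext x
  by_cases hx : x = y
  · subst hx; simp [hi.symm, hj.symm]
  · simp [hx]

theorem sum_classSize_update (F : ℕ → ℕ) {c : Fin r → ℕ} {y : Fin r} {i : ℕ} (h : c y ≠ i)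
    (hi : i < r) (hy : c y < r) :
    ∑ j ∈ Finset.range r, F (classSize (Function.update c y i) j) +
        (F (classSize c i) + F (classSize c (c y))) =
      ∑ j ∈ Finset.range r, F (classSize c j) +
        (F (classSize c i + 1) + F (classSize c (c y) - 1)) := by
  have hyr : c y ∈ (Finset.range r).erase i := by simp [h, hy]
  rw [← Finset.add_sum_erase _ _ (Finset.mem_range.2 hi),
    ← Finset.add_sum_erase _ (fun j => F (classSize c j)) (Finset.mem_range.2 hi),
    ← Finset.add_sum_erase _ _ hyr, ← Finset.add_sum_erase _ (fun j => F (classSize c j)) hyr,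
    classSize_update_self h, ← classSize_update_old h]
  have : ∑ j ∈ ((Finset.range r).erase i).erase (c y), F (classSize (Function.update c y i) j) =
      ∑ j ∈ ((Finset.range r).erase i).erase (c y), F (classSize c j) := by
    refine Finset.sum_congr rfl fun j hj => ?_
    simp only [Finset.mem_erase] at hj
    rw [classSize_update_of_ne hj.2.1 hj.1]
  rw [this, Nat.add_sub_cancel]
  ring

theorem classSize_pos (c : Fin r → ℕ) (y : Fin r) : 0 < classSize c (c y) :=
  Finset.card_pos.2 ⟨y, by simp⟩

/-- Moving a point to another class that is at least as large. -/
theorem sum_sub_le_sum_sub_update {c : Fin r → ℕ} {y : Fin r} {i : ℕ} (h : c y ≠ i)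
    (hi : i < r) (hy : c y < r) (hle : classSize c (c y) ≤ classSize c i) (k : ℕ) :
    ∑ j ∈ Finset.range r, (classSize c j - k) ≤
      ∑ j ∈ Finset.range r, (classSize (Function.update c y i) j - k) := by
  have h1 := sum_classSize_update (fun a => a - k) h hi hy
  have h2 := classSize_pos c y
  omega

/-- The strict growth serves twice: it shows that the new shape differs from the old one, and it
makes the induction on shapes terminate. -/
theorem sum_sq_lt_sum_sq_update {c : Fin r → ℕ} {y : Fin r} {i : ℕ} (h : c y ≠ i)
    (hi : i < r) (hy : c y < r) (hle : classSize c (c y) ≤ classSize c i) :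
    ∑ j ∈ Finset.range r, classSize c j ^ 2 <
      ∑ j ∈ Finset.range r, classSize (Function.update c y i) j ^ 2 := by
  have h1 := sum_classSize_update (fun a => a ^ 2) h hi hy
  have h2 := classSize_pos c y
  obtain ⟨b, hb⟩ : ∃ b, classSize c (c y) = b + 1 := ⟨_, (Nat.succ_pred_eq_of_pos h2).symm⟩
  rw [hb, Nat.add_sub_cancel] at h1
  rw [hb] at hle
  nlinarith

/-- Every colouring is, up to renaming the colours, the column colouring of a tableau. -/
theorem exists_tableau_of_colouring {c : Fin r → ℕ} (hc : ∀ x, c x < r) :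
    ∃ (mu : YoungDiagram) (t : Tableau mu r), (∀ x y, t.colOf x = t.colOf y ↔ c x = c y) ∧
      ∀ F : ℕ → ℕ, ∑ j ∈ Finset.range r, F (mu.colLen j) =
        ∑ j ∈ Finset.range r, F (classSize c j) := by
  set N : Fin r → ℕ := fun j => classSize c j with hN
  -- Sorting in the dual order lists the class sizes decreasingly, as the columns of a diagram
  -- require.
  set s : Perm (Fin r) := Tuple.sort (fun j => OrderDual.toDual (N j)) with hs
  have hanti : ∀ i j : Fin r, i ≤ j → N (s j) ≤ N (s i) := fun i j hij =>
    Tuple.monotone_sort (fun j => OrderDual.toDual (N j)) hij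
  set n' : ℕ → ℕ := fun j => if h : j < r then N (s ⟨j, h⟩) else 0 with hn'
  have hn'anti : ∀ i j, i ≤ j → n' j ≤ n' i := by
    intro i j hij
    by_cases hj : j < r
    · have hi : i < r := by omega
      simp only [hn', hj, hi, dif_pos]
      exact hanti _ _ hij
    · simp [hn', hj]
  have hn'lt : ∀ i j, i < n' j → i < r ∧ j < r := by
    intro i j hij
    by_cases hj : j < r
    · simp only [hn', hj, dif_pos] at hij
      exact ⟨lt_of_lt_of_le hij (classSize_le _ _), hj⟩
    · simp [hn', hj] at hij
  let mu : YoungDiagram :=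
    { cells := (Finset.range r ×ˢ Finset.range r).filter fun p => p.1 < n' p.2
      isLowerSet := by
        rintro ⟨a, b⟩ ⟨a', b'⟩ hle hmem
        simp only [Finset.coe_filter, Set.mem_ofPred_eq, Finset.mem_product,
          Finset.mem_range] at hmem ⊢
        have h1 : a' < n' b' := lt_of_le_of_lt hle.1 (lt_of_lt_of_le hmem.2 (hn'anti _ _ hle.2))
        exact ⟨hn'lt _ _ h1, h1⟩ }
  have hmem : ∀ i j, (i, j) ∈ mu ↔ i < n' j := by
    intro i j
    rw [← YoungDiagram.mem_cells]
    simp only [mu, Finset.mem_filter, Finset.mem_product, Finset.mem_range]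
    exact ⟨fun h => h.2, fun h => ⟨hn'lt _ _ h, h⟩⟩
  have hcol : ∀ j, mu.colLen j = n' j := by
    intro j
    refine eq_of_forall_lt_iff fun i => ?_
    rw [← YoungDiagram.mem_iff_lt_colLen, hmem]
  set c' : Fin r → ℕ := fun x => (s.symm ⟨c x, hc x⟩ : Fin r) with hc'
  have hc'iff : ∀ x y, c' x = c' y ↔ c x = c y := by
    intro x y
    simp [hc', Fin.val_inj]
  have hsize : ∀ j, classSize c' j = n' j := by
    intro j
    by_cases hj : j < r
    · simp only [hn', hj, dif_pos, hN, classSize]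
      congr 1
      ext x
      simp only [hc', Finset.mem_filter, Finset.mem_univ, true_and]
      rw [show ((s.symm ⟨c x, hc x⟩ : Fin r) : ℕ) = j ↔ s.symm ⟨c x, hc x⟩ = ⟨j, hj⟩ by
        rw [Fin.ext_iff], Equiv.symm_apply_eq, Fin.ext_iff]
    · simp only [hn', hj, dif_neg, not_false_eq_true, classSize, Finset.card_eq_zero,
        Finset.filter_eq_empty_iff]
      intro x _ h
      exact hj (h ▸ (s.symm ⟨c x, hc x⟩).2)
  have hfib : ∀ j, Nonempty ({b : Box mu // b.1.2 = j} ≃ {x // c' x = j}) := by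
    intro j
    refine Fintype.card_eq.1 ?_
    rw [Fintype.card_subtype, Fintype.card_subtype]
    change _ = classSize c' j
    rw [hsize, ← hcol, YoungDiagram.colLen_eq_card]
    refine Finset.card_bij (fun b _ => b.1) ?_ ?_ ?_
    · intro b hb
      exact YoungDiagram.mem_col_iff.2 ⟨(YoungDiagram.mem_cells _).1 b.2, by simpa using hb⟩
    · intro x _ y _ h
      exact Subtype.ext h
    · intro b hb
      obtain ⟨hb, hj⟩ := YoungDiagram.mem_col_iff.1 hb
      exact ⟨⟨b, (YoungDiagram.mem_cells _).2 hb⟩, by simpa using hj, rfl⟩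
  let t : Tableau mu r := Equiv.ofFiberEquiv (f := fun b : Box mu => b.1.2) (g := c')
    fun j => (hfib j).some
  have ht : ∀ x, t.colOf x = c' x := by
    intro x
    have := Equiv.ofFiberEquiv_map (f := fun b : Box mu => b.1.2) (g := c')
      (fun j => (hfib j).some) (t.symm x)
    rw [← t.apply_symm_apply x]
    exact (this.trans (by simp [Tableau.colOf])).symm
  refine ⟨mu, t, fun x y => by rw [ht, ht, hc'iff], fun F => ?_⟩
  rw [Finset.sum_range, Finset.sum_range, ← Equiv.sum_comp s fun j : Fin r => F (classSize c j)]
  refine Finset.sum_congr rfl fun j _ => ?_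
  rw [hcol]
  simp [hn', hN]

end Diagrams

/-! ### Minimality forces alternating vectors to vanish. -/

section Vanishing

variable {lam : YoungDiagram} {r : ℕ} {X : Type*} [Finite X] [MulAction (Perm (Fin r)) X]

/-- The permutation module on `X` has no constituents strictly below `lam`. -/
def NoConstituentBelow (lam : YoungDiagram) (r : ℕ) (X : Type*) [MulAction (Perm (Fin r)) X] :
    Prop :=
  ∀ mu : YoungDiagram, mu.card = r → Dominates lam mu → mu ≠ lam →
    ∀ f : (spechtRep mu r).IntertwiningMap (Representation.ofMulAction ℤ (Perm (Fin r)) X), f = 0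

/-- The sorted class sizes are the columns of a shape `mu` below `lam`, and `hsq` ensures `mu ≠
lam`. Every leftward exchange of `v` alternates for a still less balanced colouring, so vanishes by
induction. Hence `v` is the image of a polytabloid under a homomorphism from the Specht module of
`mu`, which is zero. -/
theorem alternating_eq_zero_of_noConstituentBelow (hr : lam.card = r)
    (hX : NoConstituentBelow lam r X) {c : Fin r → ℕ} (hc : ∀ x, c x < r)
    (hsub : ∀ k, ∑ j ∈ Finset.range r, (lam.colLen j - k) ≤
      ∑ j ∈ Finset.range r, (classSize c j - k))
    (hsq : ∑ j ∈ Finset.range r, lam.colLen j ^ 2 < ∑ j ∈ Finset.range r, classSize c j ^ 2)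
    {v : MonoidAlgebra ℤ X}
    (hv : IsAlternating (Representation.ofMulAction ℤ (Perm (Fin r)) X) c v) : v = 0 := by
  obtain ⟨M, hM⟩ : ∃ M, M = r * r ^ 2 - ∑ j ∈ Finset.range r, classSize c j ^ 2 := ⟨_, rfl⟩
  induction M using Nat.strong_induction_on generalizing c v with
  | _ M ih =>
  obtain ⟨mu, t, ht, hF⟩ := exists_tableau_of_colouring hc
  have hsub' : ∀ k, ∑ j ∈ Finset.range r, (lam.colLen j - k) ≤
      ∑ j ∈ Finset.range r, (mu.colLen j - k) := fun k => by
    rw [hF (fun a => a - k)]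
    exact hsub k
  have hsq' := hsq
  rw [← hF (fun a => a ^ 2)] at hsq'
  have hvt := hv.congr (d := t.colOf) fun x y h => (ht x y).1 h
  have hdom := dominates_of_sum_colLen_sub_le hr t.card_eq hsub'
  have hne : mu ≠ lam := by
    rintro rfl
    exact lt_irrefl _ hsq'
  have hE : HasExchange (Representation.ofMulAction ℤ (Perm (Fin r)) X) t.colOf v := by
    intro y i hi
    have hy := t.colOf_lt y
    have hle : classSize t.colOf (t.colOf y) ≤ classSize t.colOf i := by
      rw [t.classSize_colOf, t.classSize_colOf]
      exact mu.colLen_anti _ _ hi.le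
    have h1 := sum_sub_le_sum_sub_update hi.ne' (hi.trans hy) hy hle
    have h2 := sum_sq_lt_sum_sq_update hi.ne' (hi.trans hy) hy hle
    -- This bound keeps the natural subtraction in the measure `M` from truncating.
    have h3 : ∑ j ∈ Finset.range r, classSize (Function.update t.colOf y i) j ^ 2 ≤
        r * r ^ 2 := by
      refine (Finset.sum_le_card_nsmul _ _ (r ^ 2) fun j _ => ?_).trans (by simp)
      exact Nat.pow_le_pow_left (classSize_le _ _) 2
    have h4 := hF (fun a => a ^ 2)
    simp only [t.classSize_colOf] at h1 h2
    refine ih _ ?_ (c := Function.update t.colOf y i) ?_ ?_ ?_ (hvt.exchange i y) rfl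
    · rw [hM]
      omega
    · intro x
      by_cases hx : x = y
      · simpa [hx] using hi.trans hy
      · simpa [hx] using t.colOf_lt x
    · exact fun k => (hsub' k).trans (h1 k)
    · exact hsq'.trans h2
  obtain ⟨f, hf⟩ := exists_spechtHom t hvt hE
  rw [← hf, hX mu t.card_eq hdom hne f]
  rfl

/-- Recolouring a point of the column colouring of a `lam`-tableau by a smaller colour leaves no
alternating vectors. -/
theorem alternating_update_eq_zero (hX : NoConstituentBelow lam r X) (t : Tableau lam r)
    {y : Fin r} {i : ℕ} (hi : i < t.colOf y) {v : MonoidAlgebra ℤ X}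
    (hv : IsAlternating (Representation.ofMulAction ℤ (Perm (Fin r)) X)
      (Function.update t.colOf y i) v) : v = 0 := by
  have hy := t.colOf_lt y
  have hle : classSize t.colOf (t.colOf y) ≤ classSize t.colOf i := by
    rw [t.classSize_colOf, t.classSize_colOf]
    exact lam.colLen_anti _ _ hi.le
  have h1 := sum_sub_le_sum_sub_update hi.ne' (hi.trans hy) hy hle
  have h2 := sum_sq_lt_sum_sq_update hi.ne' (hi.trans hy) hy hle
  simp only [t.classSize_colOf] at h1 h2
  refine alternating_eq_zero_of_noConstituentBelow t.card_eq hX ?_ h1 h2 hv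
  intro x
  by_cases hx : x = y
  · simpa [hx] using hi.trans hy
  · simpa [hx] using t.colOf_lt x

theorem exists_spechtHom_of_noConstituentBelow (hX : NoConstituentBelow lam r X)
    (t : Tableau lam r) {v : MonoidAlgebra ℤ X}
    (hv : IsAlternating (Representation.ofMulAction ℤ (Perm (Fin r)) X) t.colOf v) :
    ∃ f : (spechtRep lam r).IntertwiningMap (Representation.ofMulAction ℤ (Perm (Fin r)) X),
      f (spechtGen t) = v :=
  exists_spechtHom t hv fun y i hi => alternating_update_eq_zero hX t hi (hv.exchange i y)

end Vanishing

/-! ### Permutations that preserve or exchange blocks. -/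

theorem image_swap_eq_self {α : Type*} [DecidableEq α] {B : Finset α} {x y : α}
    (h : x ∈ B ↔ y ∈ B) : B.image (swap x y) = B := by
  refine Finset.eq_of_subset_of_card_le ?_ ?_
  · intro z hz
    obtain ⟨w, hw, rfl⟩ := Finset.mem_image.1 hz
    by_cases hx : w = x
    · subst hx; simpa using h.1 hw
    by_cases hy : w = y
    · subst hy; simpa using h.2 hw
    rwa [swap_apply_of_ne_of_ne hx hy]
  · rw [Finset.card_image_of_injective _ (swap x y).injective]

/-- A product of disjoint transpositions, one for each point of `A`. -/
theorem exists_perm_swapping {α : Type*} [Fintype α] [DecidableEq α] (A : Finset α) (f : α → α)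
    (hinj : Set.InjOn f A) (hdisj : ∀ x ∈ A, f x ∉ A) :
    ∃ τ : Perm α, Perm.sign τ = (-1) ^ A.card ∧ (∀ x ∈ A, τ x = f x ∧ τ (f x) = x) ∧
      ∀ z, z ∉ A → z ∉ A.image f → τ z = z := by
  induction A using Finset.induction_on with
  | empty => exact ⟨1, by simp, by simp, by simp⟩
  | insert a A ha ih =>
    obtain ⟨τ, hs, h1, h2⟩ := ih (hinj.mono (by simp))
      fun x hx h => hdisj x (Finset.mem_insert_of_mem hx) (Finset.mem_insert_of_mem h)
    have hne : ∀ x ∈ A, f x ≠ a := fun x hx h =>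
      hdisj x (Finset.mem_insert_of_mem hx) (by simp [h])
    have hne' : ∀ x ∈ A, f x ≠ f a := fun x hx h => by
      have := hinj (by simp [hx]) (by simp) h
      exact ha (this ▸ hx)
    have hfa : f a ∉ insert a A := hdisj a (by simp)
    simp only [Finset.mem_insert, not_or] at hfa
    refine ⟨swap a (f a) * τ, ?_, ?_, ?_⟩
    · rw [Perm.sign_mul, hs, Perm.sign_swap (Ne.symm hfa.1), Finset.card_insert_of_notMem ha,
        pow_succ']
    · intro x hx
      rcases Finset.mem_insert.1 hx with rfl | hx
      · have hx1 : τ x = x := h2 x ha (by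
          simp only [Finset.mem_image, not_exists, not_and]; exact hne)
        have hx2 : τ (f x) = f x := h2 _ hfa.2 (by
          simp only [Finset.mem_image, not_exists, not_and]; exact hne')
        simp [hx1, hx2]
      · rw [Perm.mul_apply, Perm.mul_apply, (h1 x hx).1, (h1 x hx).2,
          swap_apply_of_ne_of_ne (hne x hx) (hne' x hx),
          swap_apply_of_ne_of_ne (ne_of_mem_of_not_mem hx ha) (ne_of_mem_of_not_mem hx hfa.2)]
        exact ⟨rfl, rfl⟩
    · intro z hz hz'
      simp only [Finset.mem_insert, not_or, Finset.image_insert] at hz hz'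
      rw [Perm.mul_apply, h2 z hz.2 hz'.2, swap_apply_of_ne_of_ne hz.1 hz'.1]

/-! ### Separated set partitions and their families of colour sets. -/

section SetPartitions

variable {m n r : ℕ}

theorem SetPartition.eq_of_mem_of_mem (p : SetPartition m n r) {B B' : Finset (Fin r)}
    {x : Fin r} (hB : B ∈ p.1) (hB' : B' ∈ p.1) (hx : x ∈ B) (hx' : x ∈ B') : B = B' :=
  (p.2.2.2 x).unique ⟨hB, hx⟩ ⟨hB', hx'⟩

theorem SetPartition.coe_smul (σ : Perm (Fin r)) (p : SetPartition m n r) :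
    (σ • p).1 = p.1.image fun B => B.image σ := rfl

theorem SetPartition.smul_eq {σ : Perm (Fin r)} {p q : SetPartition m n r}
    (h : ∀ B ∈ p.1, B.image σ ∈ q.1) : σ • p = q := by
  apply Subtype.ext
  refine Finset.eq_of_subset_of_card_le ?_ ?_
  · intro B hB
    rw [SetPartition.coe_smul] at hB
    obtain ⟨A, hA, rfl⟩ := Finset.mem_image.1 hB
    exact h A hA
  · rw [q.2.1, (σ • p).2.1]

/-- The colours in each block of `p` are distinct, and so are the colour sets of the blocks. -/
def Separates (c : Fin r → ℕ) (p : SetPartition m n r) : Prop :=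
  (∀ B ∈ p.1, Set.InjOn c B) ∧ ∀ B ∈ p.1, ∀ B' ∈ p.1, B.image c = B'.image c → B = B'

/-- The colour sets of the blocks of `p`. -/
def familyOf (c : Fin r → ℕ) (p : SetPartition m n r) : Finset (Finset ℕ) :=
  p.1.image fun B => B.image c

theorem image_image_of_mem_colourGroup {c : Fin r → ℕ} {τ : Perm (Fin r)}
    (hτ : τ ∈ colourGroup c) (B : Finset (Fin r)) : (B.image τ).image c = B.image c := by
  rw [Finset.image_image]
  exact Finset.image_congr fun x _ => hτ x

theorem familyOf_smul {c : Fin r → ℕ} {τ : Perm (Fin r)} (hτ : τ ∈ colourGroup c)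
    (p : SetPartition m n r) : familyOf c (τ • p) = familyOf c p := by
  rw [familyOf, SetPartition.coe_smul, Finset.image_image]
  exact Finset.image_congr fun B _ => image_image_of_mem_colourGroup hτ B

/-- A colour-preserving permutation that fixes `p` sends each block to one with the same colour set,
hence to itself, and then fixes each point because colours within a block are distinct. -/
theorem Separates.eq_one_of_smul_eq {c : Fin r → ℕ} {p : SetPartition m n r}
    (h : Separates c p) {τ : Perm (Fin r)} (hτ : τ ∈ colourGroup c) (hp : τ • p = p) : τ = 1 := by
  ext x : 1
  obtain ⟨B, ⟨hB, hx⟩, -⟩ := p.2.2.2 x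
  have hB' : B.image τ ∈ p.1 := by
    have hmem : B.image τ ∈ (τ • p).1 := Finset.mem_image_of_mem _ hB
    rwa [hp] at hmem
  have heq := h.2 _ hB' _ hB (image_image_of_mem_colourGroup hτ B)
  have hτx : τ x ∈ B := heq ▸ Finset.mem_image_of_mem _ hx
  exact h.1 B hB hτx hx (hτ x)

/-- For odd block size, the alternating functions are supported on separated set partitions. -/
theorem IsAlternatingFun.separates {R : Type*} [CommRing R] [IsDomain R] [CharZero R]
    (hm : Odd m) {c : Fin r → ℕ} {h : SetPartition m n r → R} (hh : IsAlternatingFun c h)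
    {p : SetPartition m n r} (hp : h p ≠ 0) : Separates c p := by
  have hinj : ∀ B ∈ p.1, Set.InjOn c B := by
    intro B hB x hx y hy hxy
    by_contra hne
    refine hp (hh.eq_zero (swap_mem_colourGroup hxy) (Perm.sign_swap hne) ?_)
    refine SetPartition.smul_eq fun A hA => ?_
    rwa [image_swap_eq_self]
    constructor
    · intro h
      rwa [p.eq_of_mem_of_mem hA hB h hx]
    · intro h
      rwa [p.eq_of_mem_of_mem hA hB h hy]
  refine ⟨hinj, fun B hB B' hB' heq => ?_⟩
  by_contra hne
  have hex : ∀ x, ∃ y, x ∈ B → y ∈ B' ∧ c y = c x := by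
    intro x
    by_cases hx : x ∈ B
    · have : c x ∈ B'.image c := heq ▸ Finset.mem_image_of_mem c hx
      obtain ⟨y, hy, hxy⟩ := Finset.mem_image.1 this
      exact ⟨y, fun _ => ⟨hy, hxy⟩⟩
    · exact ⟨x, fun h => absurd h hx⟩
  choose f hf using hex
  have hfinj : Set.InjOn f B := by
    intro x hx y hy hxy
    refine hinj B hB hx hy ?_
    rw [← (hf x hx).2, ← (hf y hy).2, hxy]
  have hfdisj : ∀ x ∈ B, f x ∉ B := fun x hx hfx =>
    hne (p.eq_of_mem_of_mem hB hB' hfx (hf x hx).1)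
  have hfB : B.image f = B' := by
    refine Finset.eq_of_subset_of_card_le ?_ ?_
    · intro z hz
      obtain ⟨x, hx, rfl⟩ := Finset.mem_image.1 hz
      exact (hf x hx).1
    · rw [Finset.card_image_of_injOn hfinj, p.2.2.1 B hB, p.2.2.1 B' hB']
  obtain ⟨τ, hs, h1, h2⟩ := exists_perm_swapping B f hfinj hfdisj
  -- The colour-preserving exchange of the two blocks is a product of `m` transpositions, so it is
  -- odd; it fixes `p`, which forces the value there to vanish.
  rw [p.2.2.1 B hB, hm.neg_one_pow] at hs
  have hfim : ∀ z ∈ B', ∃ x ∈ B, f x = z := fun z hz => by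
    rw [← hfB] at hz
    exact Finset.mem_image.1 hz
  refine hp (hh.eq_zero (τ := τ) ?_ hs ?_)
  · intro z
    by_cases hz : z ∈ B
    · rw [(h1 z hz).1, (hf z hz).2]
    by_cases hz' : z ∈ B'
    · obtain ⟨x, hx, rfl⟩ := hfim z hz'
      rw [(h1 x hx).2, (hf x hx).2]
    · rw [h2 z hz (hfB ▸ hz')]
  · refine SetPartition.smul_eq fun A hA => ?_
    by_cases hAB : A = B
    · rw [hAB, Finset.image_congr (g := f) fun x hx => (h1 x hx).1, hfB]
      exact hB'
    by_cases hAB' : A = B'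
    · have : A.image τ = B := by
        refine Finset.eq_of_subset_of_card_le ?_ ?_
        · intro z hz
          obtain ⟨w, hw, rfl⟩ := Finset.mem_image.1 hz
          obtain ⟨x, hx, rfl⟩ := hfim w (hAB' ▸ hw)
          rwa [(h1 x hx).2]
        · rw [Finset.card_image_of_injective _ τ.injective, p.2.2.1 B hB, p.2.2.1 A hA]
      rwa [this]
    · have : A.image τ = A := by
        rw [Finset.image_congr (g := id), Finset.image_id]
        intro x hx
        exact h2 x (fun h => hAB (p.eq_of_mem_of_mem hA hB hx h))
          (fun h => hAB' (p.eq_of_mem_of_mem hA hB' hx (hfB ▸ h)))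
      rwa [this]

/-- Blocks are matched by their colour sets and points within matched blocks by their colours;
separation makes both matchings unambiguous. -/
theorem Separates.exists_smul_eq {c : Fin r → ℕ} {p q : SetPartition m n r}
    (hp : Separates c p) (hq : Separates c q) (h : familyOf c p = familyOf c q) :
    ∃ τ ∈ colourGroup c, τ • p = q := by
  have hcorr : ∀ B ∈ p.1, ∃ B' ∈ q.1, B'.image c = B.image c := fun B hB => by
    have : B.image c ∈ familyOf c q := h ▸ Finset.mem_image_of_mem _ hB
    exact Finset.mem_image.1 this
  have hex : ∀ x, ∃ y, c y = c x ∧ ∃ B ∈ p.1, x ∈ B ∧ ∃ B' ∈ q.1, y ∈ B' ∧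
      B'.image c = B.image c := by
    intro x
    obtain ⟨B, ⟨hB, hx⟩, -⟩ := p.2.2.2 x
    obtain ⟨B', hB', heq⟩ := hcorr B hB
    have : c x ∈ B'.image c := heq ▸ Finset.mem_image_of_mem c hx
    obtain ⟨y, hy, hxy⟩ := Finset.mem_image.1 this
    exact ⟨y, hxy, B, hB, hx, B', hB', hy, heq⟩
  choose f hfc hf using hex
  have hfinj : Function.Injective f := by
    intro x y hxy
    obtain ⟨B₁, hB₁, hx, B₁', hB₁', hx', h₁⟩ := hf x
    obtain ⟨B₂, hB₂, hy, B₂', hB₂', hy', h₂⟩ := hf y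
    rw [hxy] at hx'
    have : B₁' = B₂' := q.eq_of_mem_of_mem hB₁' hB₂' hx' hy'
    have hB : B₁ = B₂ := hp.2 _ hB₁ _ hB₂ (by rw [← h₁, ← h₂, this])
    refine hp.1 B₁ hB₁ hx (hB ▸ hy) ?_
    rw [← hfc x, ← hfc y, hxy]
  refine ⟨Equiv.ofBijective f (Finite.injective_iff_bijective.1 hfinj), hfc, ?_⟩
  refine SetPartition.smul_eq fun B hB => ?_
  obtain ⟨B', hB', heq⟩ := hcorr B hB
  have : B.image (Equiv.ofBijective f (Finite.injective_iff_bijective.1 hfinj)) = B' := by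
    refine Finset.eq_of_subset_of_card_le ?_ ?_
    · intro z hz
      obtain ⟨x, hx, rfl⟩ := Finset.mem_image.1 hz
      obtain ⟨B₁, hB₁, hx₁, B₁', hB₁', hx', h₁⟩ := hf x
      have h2 := p.eq_of_mem_of_mem hB hB₁ hx hx₁
      rw [hq.2 _ hB' _ hB₁' (by rw [heq, h₁, h2])]
      exact hx'
    · rw [Finset.card_image_of_injective _ (Equiv.injective _), q.2.2.1 B' hB', p.2.2.1 B hB]
  rwa [this]

theorem Separates.isSetFamily {c : Fin r → ℕ} {p : SetPartition m n r} (h : Separates c p) :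
    IsSetFamily m n (familyOf c p) := by
  constructor
  · rw [familyOf, Finset.card_image_of_injOn (fun B hB B' hB' heq => h.2 B hB B' hB' heq), p.2.1]
  · intro X hX
    obtain ⟨B, hB, rfl⟩ := Finset.mem_image.1 hX
    rw [Finset.card_image_of_injOn (h.1 B hB), p.2.2.1 B hB]

theorem Separates.card_filter_mem {c : Fin r → ℕ} {p : SetPartition m n r} (h : Separates c p)
    (i : ℕ) : ((familyOf c p).filter fun X => i ∈ X).card = classSize c i := by
  symm
  choose b hb hb' using p.2.2.2
  refine Finset.card_bij (fun x _ => (b x).image c) ?_ ?_ ?_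
  · intro x hx
    simp only [Finset.mem_filter, Finset.mem_univ, true_and] at hx
    refine Finset.mem_filter.2 ⟨Finset.mem_image_of_mem _ (hb x).1, ?_⟩
    rw [← hx]
    exact Finset.mem_image_of_mem c (hb x).2
  · intro x hx y hy hxy
    simp only [Finset.mem_filter, Finset.mem_univ, true_and] at hx hy
    have := h.2 _ (hb x).1 _ (hb y).1 hxy
    exact h.1 _ (hb x).1 (hb x).2 (this ▸ (hb y).2) (hx.trans hy.symm)
  · intro X hX
    obtain ⟨hX, hi⟩ := Finset.mem_filter.1 hX
    obtain ⟨B, hB, rfl⟩ := Finset.mem_image.1 hX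
    obtain ⟨x, hx, hxi⟩ := Finset.mem_image.1 hi
    refine ⟨x, by simpa using hxi, ?_⟩
    rw [p.eq_of_mem_of_mem (hb x).1 hB (hb x).2 hx]

/-- Only the block of `y` changes its colour set; `hi` keeps its colours distinct and `hnot` keeps
its new colour set from coinciding with another. -/
theorem Separates.update {c : Fin r → ℕ} {p : SetPartition m n r} (h : Separates c p)
    {B : Finset (Fin r)} (hB : B ∈ p.1) {y : Fin r} (hy : y ∈ B) {i : ℕ} (hi : i ∉ B.image c)
    (hnot : insert i ((B.image c).erase (c y)) ∉ familyOf c p) :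
    Separates (Function.update c y i) p := by
  have hout : ∀ A ∈ p.1, A ≠ B → ∀ x ∈ A, Function.update c y i x = c x := by
    intro A hA hne x hx
    rw [Function.update_of_ne]
    rintro rfl
    exact hne (p.eq_of_mem_of_mem hA hB hx hy)
  have himout : ∀ A ∈ p.1, A ≠ B → A.image (Function.update c y i) = A.image c :=
    fun A hA hne => Finset.image_congr (hout A hA hne)
  have hiB : ∀ x ∈ B, c x ≠ i := fun x hx hxi => hi (hxi ▸ Finset.mem_image_of_mem c hx)
  have himB : B.image (Function.update c y i) = insert i ((B.image c).erase (c y)) := by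
    ext z
    simp only [Finset.mem_image, Finset.mem_insert, Finset.mem_erase]
    constructor
    · rintro ⟨x, hx, rfl⟩
      by_cases hxy : x = y
      · simp [hxy]
      · rw [Function.update_of_ne hxy]
        exact Or.inr ⟨fun hc => hxy (h.1 B hB hx hy hc), x, hx, rfl⟩
    · rintro (rfl | ⟨hz, x, hx, rfl⟩)
      · exact ⟨y, hy, by simp⟩
      · refine ⟨x, hx, ?_⟩
        rw [Function.update_of_ne]
        rintro rfl
        exact hz rfl
  have himne : ∀ A ∈ p.1, A ≠ B →
      A.image (Function.update c y i) ≠ B.image (Function.update c y i) := by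
    intro A hA hne heq
    rw [himout A hA hne, himB] at heq
    exact hnot (heq ▸ Finset.mem_image_of_mem _ hA)
  constructor
  · intro A hA x hx x' hx' heq
    by_cases hAB : A = B
    · subst hAB
      by_cases hxy : x = y <;> by_cases hxy' : x' = y
      · rw [hxy, hxy']
      · subst hxy
        rw [Function.update_self, Function.update_of_ne hxy'] at heq
        exact absurd heq.symm (hiB x' hx')
      · subst hxy'
        rw [Function.update_self, Function.update_of_ne hxy] at heq
        exact absurd heq (hiB x hx)
      · rw [Function.update_of_ne hxy, Function.update_of_ne hxy'] at heq
        exact h.1 A hA hx hx' heq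
    · rw [hout A hA hAB x hx, hout A hA hAB x' hx'] at heq
      exact h.1 A hA hx hx' heq
  · intro A hA A' hA' heq
    by_cases hAB : A = B <;> by_cases hAB' : A' = B
    · rw [hAB, hAB']
    · exact absurd (hAB ▸ heq.symm) (himne A' hA' hAB')
    · exact absurd (hAB' ▸ heq) (himne A hA hAB)
    · rw [himout A hA hAB, himout A' hA' hAB'] at heq
      exact h.2 A hA A' hA' heq

end SetPartitions

/-! ### The set partitions `u_P` as orbit representatives. -/

section IndexedSetPartitions

variable {m n r : ℕ} {lam : YoungDiagram}

theorem image_colOf_indexedBlock (ι : IndexedSymbol lam ≃ Fin r) (P : FamilyOfType m n lam)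
    {X : Finset ℕ} (hX : X ∈ P.1) :
    (indexedBlock ι P.1 X).image (canonicalTableau ι).colOf = X :=
  image_number_indexedBlock ι P.2.2 hX

theorem familyOf_indexedSetPartition (ι : IndexedSymbol lam ≃ Fin r) (P : FamilyOfType m n lam) :
    familyOf (canonicalTableau ι).colOf (indexedSetPartition ι P) = P.1 := by
  rw [familyOf, indexedSetPartition, Finset.image_image]
  conv_rhs => rw [← Finset.image_id (s := P.1)]
  exact Finset.image_congr fun X hX => image_colOf_indexedBlock ι P hX

theorem separates_indexedSetPartition (ι : IndexedSymbol lam ≃ Fin r)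
    (P : FamilyOfType m n lam) :
    Separates (canonicalTableau ι).colOf (indexedSetPartition ι P) := by
  constructor
  · intro B hB
    have hcard := (indexedSetPartition ι P).2.2.1 B hB
    obtain ⟨X, hX, rfl⟩ := Finset.mem_image.1 hB
    apply Finset.card_image_iff.1
    rw [image_colOf_indexedBlock ι P hX, hcard, P.2.1.2 X hX]
  · intro B hB B' hB' heq
    obtain ⟨X, hX, rfl⟩ := Finset.mem_image.1 hB
    obtain ⟨X', hX', rfl⟩ := Finset.mem_image.1 hB'
    rw [image_colOf_indexedBlock ι P hX, image_colOf_indexedBlock ι P hX'] at heq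
    rw [heq]

theorem indexedSetPartition_injective (ι : IndexedSymbol lam ≃ Fin r) :
    Function.Injective (indexedSetPartition (m := m) (n := n) ι) := by
  intro P Q h
  apply Subtype.ext
  rw [← familyOf_indexedSetPartition ι P, h, familyOf_indexedSetPartition]

theorem finite_familyOfType (ι : IndexedSymbol lam ≃ Fin r) : Finite (FamilyOfType m n lam) :=
  Finite.of_injective _ (indexedSetPartition_injective (m := m) (n := n) ι)

/-- For odd block size, an alternating function is determined by its values at the indexed set
partitions of the families of type `lam`. -/
theorem IsAlternatingFun.eq_zero_of_indexed {R : Type*} [CommRing R] [IsDomain R] [CharZero R]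
    (hm : Odd m) (ι : IndexedSymbol lam ≃ Fin r) {h : SetPartition m n r → R}
    (hh : IsAlternatingFun (canonicalTableau ι).colOf h)
    (h0 : ∀ P : FamilyOfType m n lam, h (indexedSetPartition ι P) = 0) (p : SetPartition m n r) :
    h p = 0 := by
  by_contra hp
  have hsep := hh.separates hm hp
  let P : FamilyOfType m n lam := ⟨familyOf (canonicalTableau ι).colOf p, hsep.isSetFamily,
    fun i => by rw [hsep.card_filter_mem, Tableau.classSize_colOf]⟩
  obtain ⟨τ, hτ, hτp⟩ := hsep.exists_smul_eq (separates_indexedSetPartition ι P)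
    (familyOf_indexedSetPartition ι P).symm
  refine hh.smul_ne_zero hτ hp ?_
  rw [hτp, h0]

open Classical in
theorem coeff_signedSum_indexedSetPartition (ι : IndexedSymbol lam ≃ Fin r)
    (P Q : FamilyOfType m n lam) :
    ((Representation.ofMulAction ℤ (Perm (Fin r)) (SetPartition m n r)).asAlgebraHom
      (signedSum ℤ (canonicalTableau ι).colOf) (single (indexedSetPartition ι P) 1)).coeff
        (indexedSetPartition ι Q) = (Pi.single P 1 : FamilyOfType m n lam → ℤ) Q := by
  by_cases hPQ : Q = P
  · subst hPQ
    rw [Pi.single_eq_same]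
    exact coeff_signedSum_single_self fun τ hτ =>
      (separates_indexedSetPartition ι Q).eq_one_of_smul_eq hτ
  · rw [Pi.single_eq_of_ne hPQ]
    by_contra hne
    obtain ⟨τ, hτ, hτP⟩ := exists_of_coeff_signedSum_single_ne_zero hne
    apply hPQ
    apply Subtype.ext
    rw [← familyOf_indexedSetPartition ι Q, ← hτP, familyOf_smul hτ,
      familyOf_indexedSetPartition]

end IndexedSetPartitions

/-! ### Closedness of the families. -/

section Closed

/-- A family is closed if it is closed under replacing an element by a smaller one. -/
theorem isClosedFamily_of_replace {P : Finset (Finset ℕ)}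
    (h : ∀ Y ∈ P, ∀ j ∈ Y, ∀ i ∉ Y, i < j → insert i (Y.erase j) ∈ P) : IsClosedFamily P := by
  suffices H : ∀ s : ℕ, ∀ Y ∈ P, ∑ x ∈ Y, x = s → ∀ X, Majorizes Y X → X ∈ P from
    fun Y hY X hX _ => H _ Y hY rfl X hX
  intro s
  induction s using Nat.strong_induction_on with
  | _ s ih =>
  rintro Y hY hs X ⟨k, hXk, hYk, hle⟩
  by_cases hXY : X = Y
  · rwa [hXY]
  set x := X.orderEmbOfFin hXk with hx
  set y := Y.orderEmbOfFin hYk with hy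
  have hex : ∃ l, x l ≠ y l := by
    by_contra! hall
    apply hXY
    rw [← Finset.coe_inj, ← Finset.range_orderEmbOfFin X hXk, ← Finset.range_orderEmbOfFin Y hYk]
    congr 1
    exact funext hall
  -- Replacing `y l` by `x l` at the first disagreement keeps the listing increasing and above that
  -- of `X`, and lowers the sum of the elements.
  obtain ⟨l, hl, hmin⟩ := wellFounded_lt.has_min {l : Fin k | x l ≠ y l} hex
  have hmin' : ∀ a < l, x a = y a := fun a ha => by
    by_contra hne
    exact hmin a hne ha
  have hlt : x l < y l := lt_of_le_of_ne (hle l) hl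
  have hyY : y l ∈ Y := Finset.orderEmbOfFin_mem Y hYk l
  have hxY : x l ∉ Y := by
    intro hmem
    have hr : x l ∈ Set.range y := by
      rw [hy, Finset.range_orderEmbOfFin]; exact hmem
    obtain ⟨q, hq⟩ := hr
    have hql : q < l := y.lt_iff_lt.1 (hq ▸ hlt)
    have h2 := hmin' q hql
    rw [hq] at h2
    exact hql.ne (x.injective h2)
  have hY'P := h Y hY _ hyY _ hxY hlt
  set Y' := insert (x l) (Y.erase (y l)) with hY'
  have hnot : x l ∉ Y.erase (y l) := fun h => hxY (Finset.mem_of_mem_erase h)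
  have hcard : Y'.card = k := by
    rw [hY', Finset.card_insert_of_notMem hnot, Finset.card_erase_add_one hyY, hYk]
  have hsum : ∑ z ∈ Y', z < s := by
    rw [hY', Finset.sum_insert hnot, ← hs, ← Finset.add_sum_erase Y _ hyY]
    simpa using hlt
  have hmono : StrictMono (Function.update y l (x l)) := by
    intro a b hab
    by_cases ha : a = l
    · subst ha
      rw [Function.update_self, Function.update_of_ne hab.ne']
      exact hlt.trans (y.strictMono hab)
    · rw [Function.update_of_ne ha]
      by_cases hb : b = l
      · subst hb
        rw [Function.update_self, ← hmin' a hab]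
        exact x.strictMono hab
      · rw [Function.update_of_ne hb]
        exact y.strictMono hab
  have hmem : ∀ a, Function.update y l (x l) a ∈ Y' := by
    intro a
    by_cases ha : a = l
    · subst ha; simp [hY']
    · rw [Function.update_of_ne ha]
      exact Finset.mem_insert_of_mem (Finset.mem_erase.2
        ⟨fun he => ha (y.injective he), Finset.orderEmbOfFin_mem Y hYk a⟩)
  have huniq := Finset.orderEmbOfFin_unique hcard hmem hmono
  refine ih _ hsum Y' hY'P rfl X ⟨k, hXk, hcard, fun a => ?_⟩
  rw [← huniq]
  by_cases ha : a = l
  · subst ha; simp [← hx]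
  · rw [Function.update_of_ne ha]
    exact hle a

/-- If the replacement of `j` by `i` in `Y` is missing from the family, then recolouring one symbol
from `j` to `i` leaves `u_P` separated. Its signed sum for the new colouring has coefficient `1` at
`u_P`, although minimality forces that alternating vector to be zero. -/
theorem isClosedFamily_of_noConstituentBelow {m n r : ℕ} {lam : YoungDiagram}
    (hX : NoConstituentBelow lam r (SetPartition m n r)) (ι : IndexedSymbol lam ≃ Fin r)
    (P : FamilyOfType m n lam) : IsClosedFamily P.1 := by
  refine isClosedFamily_of_replace fun Y hY j hj i hi hij => ?_
  by_contra hnot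
  set t := canonicalTableau ι
  set p := indexedSetPartition ι P with hp
  have hB : indexedBlock ι P.1 Y ∈ p.1 := Finset.mem_image_of_mem _ hY
  have him : (indexedBlock ι P.1 Y).image t.colOf = Y := image_colOf_indexedBlock ι P hY
  obtain ⟨y, hy, hyj⟩ := Finset.mem_image.1 (him.symm ▸ hj)
  have hsep : Separates (Function.update t.colOf y i) p := by
    refine (separates_indexedSetPartition ι P).update hB hy (by rwa [him]) ?_
    rwa [him, hyj, familyOf_indexedSetPartition]
  have h0 := alternating_update_eq_zero hX t (y := y) (i := i) (by rwa [hyj])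
    (isAlternating_signedSum _ (single p 1))
  have h1 := coeff_signedSum_single_self (R := ℤ) fun τ hτ => hsep.eq_one_of_smul_eq hτ
  rw [h0] at h1
  simp at h1

end Closed

/-! ### Character inner products and extension of scalars. -/

section RationalCharacters

variable {G V W : Type*} [Group G] [AddCommGroup V] [AddCommGroup W]
  {σ : Representation ℤ G W} {ρ : Representation ℤ G V}

theorem rationalRep_apply_tmul (g : G) (q : ℚ) (v : V) :
    rationalRep ρ g (q ⊗ₜ v) = q ⊗ₜ ρ g v := rfl

theorem charInner_rationalRep [Fintype G] [Module.Finite ℤ V] [Module.Finite ℤ W] :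
    charInner (rationalRep ρ).character (rationalRep σ).character =
      Module.finrank ℚ ((rationalRep σ).IntertwiningMap (rationalRep ρ)) := by
  have : Invertible (Nat.card G : ℚ) :=
    invertibleOfNonzero (by exact_mod_cast Nat.card_pos.ne')
  rw [← Representation.card_inv_mul_sum_char_mul_char_eq_finrank, charInner, div_eq_inv_mul,
    Nat.card_eq_fintype_card]

/-- Extension of scalars of a homomorphism of integral representations. -/
noncomputable def rationalHom (f : σ.IntertwiningMap ρ) :
    (rationalRep σ).IntertwiningMap (rationalRep ρ) where
  toLinearMap := f.toLinearMap.baseChange ℚ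
  isIntertwining' g := by
    ext w
    simp [rationalRep, f.isIntertwining]

theorem rationalHom_apply_tmul (f : σ.IntertwiningMap ρ) (q : ℚ) (w : W) :
    rationalHom f (q ⊗ₜ w) = q ⊗ₜ f w := rfl

theorem isAlternating_one_tmul {α β : Type*} [Fintype α] [DecidableEq α]
    {ρ : Representation ℤ (Perm α) V} {c : α → β} {v : V} (h : IsAlternating ρ c v) :
    IsAlternating (rationalRep ρ) c ((1 : ℚ) ⊗ₜ[ℤ] v) := by
  intro τ hτ
  rw [rationalRep_apply_tmul, h τ hτ, ← TensorProduct.smul_tmul, TensorProduct.smul_tmul']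
  congr 1

theorem IsAlternating.map {k α β V W : Type*} [CommRing k] [Fintype α] [DecidableEq α]
    [AddCommGroup V] [Module k V] [AddCommGroup W] [Module k W]
    {σ : Representation k (Perm α) W} {ρ : Representation k (Perm α) V} {c : α → β} {w : W}
    (h : IsAlternating σ c w) (f : σ.IntertwiningMap ρ) : IsAlternating ρ c (f w) := by
  intro τ hτ
  rw [← f.isIntertwining, h τ hτ, map_smul]

end RationalCharacters

/-! ### Coordinates in rational permutation modules. -/

section RationalCoefficients

variable {G X : Type*} [Group G] [MulAction G X]

/-- The coefficient of a point of `X` in the rational permutation module. -/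
noncomputable def rationalCoeff (p : X) : ℚ ⊗[ℤ] MonoidAlgebra ℤ X →ₗ[ℚ] ℚ :=
  (TensorProduct.AlgebraTensorModule.rid ℤ ℚ ℚ).toLinearMap ∘ₗ
    (Finsupp.lapply p ∘ₗ (coeffLinearEquiv ℤ).toLinearMap :
      MonoidAlgebra ℤ X →ₗ[ℤ] ℤ).baseChange ℚ

theorem rationalCoeff_tmul (p : X) (q : ℚ) (f : MonoidAlgebra ℤ X) :
    rationalCoeff p (q ⊗ₜ f) = f.coeff p * q := by
  simp [rationalCoeff]

theorem rationalCoeff_rationalRep (g : G) (p : X) (w : ℚ ⊗[ℤ] MonoidAlgebra ℤ X) :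
    rationalCoeff p (rationalRep (Representation.ofMulAction ℤ G X) g w) =
      rationalCoeff (g⁻¹ • p) w := by
  induction w using TensorProduct.induction_on with
  | zero => simp
  | tmul q f =>
    rw [rationalRep_apply_tmul, rationalCoeff_tmul, rationalCoeff_tmul,
      Representation.coeff_ofMulAction]
  | add x y hx hy => rw [map_add, map_add, map_add, hx, hy]

theorem eq_zero_of_rationalCoeff [Finite X] {w : ℚ ⊗[ℤ] MonoidAlgebra ℤ X}
    (h : ∀ p, rationalCoeff p w = 0) : w = 0 := by
  have := Fintype.ofFinite X
  suffices H : w = ∑ p, rationalCoeff p w • ((1 : ℚ) ⊗ₜ[ℤ] (single p 1 : MonoidAlgebra ℤ X)) by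
    rw [H]; simp [h]
  clear h
  induction w using TensorProduct.induction_on with
  | zero => simp
  | tmul q f =>
    have hf : f = ∑ p, f.coeff p • (single p 1 : MonoidAlgebra ℤ X) := by
      ext x
      simp [coeff_sum]
    conv_lhs => rw [hf]
    rw [TensorProduct.tmul_sum]
    refine Finset.sum_congr rfl fun p _ => ?_
    rw [rationalCoeff_tmul, TensorProduct.tmul_smul, TensorProduct.smul_tmul',
      TensorProduct.smul_tmul']
    simp
  | add x y hx hy =>
    simp only [map_add, add_smul, Finset.sum_add_distrib]
    rw [← hx, ← hy]

theorem isAlternatingFun_rationalCoeff {α β : Type*} [Fintype α] [DecidableEq α]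
    [MulAction (Perm α) X] {c : α → β} {w : ℚ ⊗[ℤ] MonoidAlgebra ℤ X}
    (h : IsAlternating (rationalRep (Representation.ofMulAction ℤ (Perm α) X)) c w) :
    IsAlternatingFun c fun p => rationalCoeff p w := by
  intro τ hτ p
  have h1 := congrArg (rationalCoeff p) (h τ⁻¹ (inv_mem hτ))
  rw [rationalCoeff_rationalRep, inv_inv, map_smul] at h1
  simpa using h1

end RationalCoefficients

/-! ### The basis of homomorphisms and the multiplicity. -/

section Multiplicity

variable {m n r : ℕ} {lam : YoungDiagram}

instance : Module.Finite ℤ (MonoidAlgebra ℤ (Tabloid lam r)) :=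
  Module.Finite.equiv (coeffLinearEquiv ℤ).symm

instance : Module.Finite ℤ (MonoidAlgebra ℤ (SetPartition m n r)) :=
  Module.Finite.equiv (coeffLinearEquiv ℤ).symm

theorem rationalHom_ext_spechtGen {V : Type*} [AddCommGroup V]
    {ρ : Representation ℤ (Perm (Fin r)) V} (t : Tableau lam r)
    {F : (rationalRep (spechtRep lam r)).IntertwiningMap (rationalRep ρ)}
    (h : F ((1 : ℚ) ⊗ₜ spechtGen t) = 0) : F = 0 := by
  have key : ∀ (a : MonoidAlgebra ℤ (Perm (Fin r))),
      F ((1 : ℚ) ⊗ₜ (spechtRep lam r).asAlgebraHom a (spechtGen t)) = 0 := by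
    intro a
    induction a using MonoidAlgebra.induction_linear with
    | zero => simp
    | add a b ha hb => simp [TensorProduct.tmul_add, ha, hb]
    | single g z =>
      rw [Representation.asAlgebraHom_single, LinearMap.smul_apply, TensorProduct.tmul_smul,
        map_zsmul, ← rationalRep_apply_tmul, F.isIntertwining, h, map_zero, smul_zero]
  apply Representation.IntertwiningMap.ext
  ext w : 3
  obtain ⟨a, rfl⟩ := spechtGen_generates t w
  exact key a

/-- A zero inner product means that there are no nonzero rational homomorphisms; an integral one is
determined by its extension to `ℚ`, as is seen on coefficients. -/
theorem noConstituentBelow_of_isMinimalConstituent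
    (hmin : IsMinimalConstituent (foulkesChar m n) lam) :
    NoConstituentBelow lam (m * n) (SetPartition m n (m * n)) := by
  intro mu hmu hdom hne f
  have h0 := hmin.2 mu hmu hdom hne
  rw [foulkesChar, spechtChar, charInner_rationalRep, Nat.cast_eq_zero,
    Module.finrank_zero_iff] at h0
  have hF : rationalHom f = 0 := Subsingleton.elim _ _
  apply Representation.IntertwiningMap.ext
  ext w p
  have h1 : rationalHom f ((1 : ℚ) ⊗ₜ w) = 0 := by rw [hF]; rfl
  rw [rationalHom_apply_tmul] at h1
  have h2 := congrArg (rationalCoeff p) h1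
  rw [rationalCoeff_tmul, map_zero, mul_one] at h2
  exact_mod_cast h2

theorem isAlternating_spechtGen (t : Tableau lam r) :
    IsAlternating (spechtRep lam r) t.colOf (spechtGen t) :=
  fun τ hτ => Subtype.ext (isAlternating_polytabloid t τ hτ)

/-- The coefficients of the image of `e_t` at the indexed set partitions. -/
noncomputable def indexedCoeffs (ι : IndexedSymbol lam ≃ Fin (m * n)) :
    SpechtFoulkesHom m n lam →ₗ[ℤ] FamilyOfType m n lam → ℤ where
  toFun f P := (f (spechtGen (canonicalTableau ι))).coeff (indexedSetPartition ι P)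
  map_add' _ _ := rfl
  map_smul' _ _ := rfl

theorem indexedCoeffs_apply (ι : IndexedSymbol lam ≃ Fin (m * n)) (f : SpechtFoulkesHom m n lam)
    (P : FamilyOfType m n lam) : indexedCoeffs ι f P =
      (f (spechtGen (canonicalTableau ι))).coeff (indexedSetPartition ι P) := rfl

open Classical in
theorem IsFamilyHom.indexedCoeffs {ι : IndexedSymbol lam ≃ Fin (m * n)}
    {P : FamilyOfType m n lam} {f : SpechtFoulkesHom m n lam} (h : IsFamilyHom ι P f) :
    indexedCoeffs ι f = Pi.single P 1 := by
  ext Q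
  rw [indexedCoeffs_apply, h, columnSum_eq_signedSum, coeff_signedSum_indexedSetPartition]

/-- The image of the generator alternates, so its values on the orbit representatives `u_P`
determine it, and it determines the homomorphism. -/
theorem indexedCoeffs_injective (hm : Odd m) (ι : IndexedSymbol lam ≃ Fin (m * n)) :
    Function.Injective (indexedCoeffs ι) := by
  rw [← LinearMap.ker_eq_bot, LinearMap.ker_eq_bot']
  intro f hf
  apply intertwiningMap_ext_spechtGen (canonicalTableau ι)
  ext p
  exact ((isAlternating_spechtGen (canonicalTableau ι)).map f).isAlternatingFun.eq_zero_of_indexed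
    hm ι (fun P => congrFun hf P) p

theorem exists_isFamilyHom (hX : NoConstituentBelow lam (m * n) (SetPartition m n (m * n)))
    (ι : IndexedSymbol lam ≃ Fin (m * n)) (P : FamilyOfType m n lam) :
    ∃ f, IsFamilyHom ι P f := by
  obtain ⟨f, hf⟩ := exists_spechtHom_of_noConstituentBelow hX (canonicalTableau ι)
    (isAlternating_signedSum _ (single (indexedSetPartition ι P) 1))
  exact ⟨f, by rw [IsFamilyHom, columnSum_eq_signedSum]; exact hf⟩

/-- The coordinates at the `u_P` are integers and send `f_P` to the unit vector at `P`. This gives a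
basis over `ℤ`, with no denominators to clear. -/
theorem exists_basis_isFamilyHom (hm : Odd m)
    (hX : NoConstituentBelow lam (m * n) (SetPartition m n (m * n)))
    (ι : IndexedSymbol lam ≃ Fin (m * n)) :
    ∃ b : Module.Basis (FamilyOfType m n lam) ℤ (SpechtFoulkesHom m n lam),
      ∀ (P : FamilyOfType m n lam) (f : SpechtFoulkesHom m n lam),
        IsFamilyHom ι P f ↔ f = b P := by
  classical
  have := finite_familyOfType (m := m) (n := n) ι
  have := Fintype.ofFinite (FamilyOfType m n lam)
  choose F hF using exists_isFamilyHom hX ι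
  have hinj := indexedCoeffs_injective hm ι
  have hsurj : Function.Surjective (indexedCoeffs (m := m) (n := n) ι) := by
    intro y
    refine ⟨∑ P, y P • F P, ?_⟩
    rw [map_sum]
    simp only [map_smul, (hF _).indexedCoeffs]
    exact (pi_eq_sum_univ' y).symm
  let e := LinearEquiv.ofBijective (indexedCoeffs ι) ⟨hinj, hsurj⟩
  have he : ∀ P, Module.Basis.ofEquivFun e P = F P := by
    intro P
    rw [Module.Basis.coe_ofEquivFun, LinearEquiv.symm_apply_eq]
    exact (hF P).indexedCoeffs.symm
  refine ⟨Module.Basis.ofEquivFun e, fun P f => ⟨fun h => hinj ?_, fun h => ?_⟩⟩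
  · rw [he, h.indexedCoeffs, (hF P).indexedCoeffs]
  · rw [h, he]
    exact hF P

/-- The inner product is the dimension of the rational space of homomorphisms. The coordinate
argument is repeated over `ℚ`, with surjectivity supplied by the extended integral homomorphisms. -/
theorem charInner_foulkesChar_spechtChar (hm : Odd m)
    (hX : NoConstituentBelow lam (m * n) (SetPartition m n (m * n)))
    (ι : IndexedSymbol lam ≃ Fin (m * n)) :
    charInner (foulkesChar m n) (spechtChar lam (m * n)) = Nat.card (FamilyOfType m n lam) := by
  classical
  have := finite_familyOfType (m := m) (n := n) ι
  have := Fintype.ofFinite (FamilyOfType m n lam)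
  rw [foulkesChar, spechtChar, charInner_rationalRep]
  set t := canonicalTableau ι
  let C : (rationalRep (spechtRep lam (m * n))).IntertwiningMap (rationalRep (foulkesRep m n)) →ₗ[ℚ]
      FamilyOfType m n lam → ℚ :=
    { toFun := fun F P => rationalCoeff (indexedSetPartition ι P) (F ((1 : ℚ) ⊗ₜ spechtGen t))
      map_add' := fun F F' => by ext P; simp
      map_smul' := fun q F => by ext P; simp }
  have hinj : Function.Injective C := by
    rw [← LinearMap.ker_eq_bot, LinearMap.ker_eq_bot']
    intro F hF
    apply rationalHom_ext_spechtGen t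
    apply eq_zero_of_rationalCoeff
    have halt := isAlternatingFun_rationalCoeff
      ((isAlternating_one_tmul (isAlternating_spechtGen t)).map F)
    exact halt.eq_zero_of_indexed hm ι fun P => congrFun hF P
  choose F hF using exists_isFamilyHom hX ι
  have hCF : ∀ P, C (rationalHom (F P)) = Pi.single P 1 := by
    intro P
    ext Q
    have hC : C (rationalHom (F P)) Q = rationalCoeff (indexedSetPartition ι Q)
        (rationalHom (F P) ((1 : ℚ) ⊗ₜ spechtGen t)) := rfl
    rw [hC, rationalHom_apply_tmul, rationalCoeff_tmul, mul_one, ← indexedCoeffs_apply,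
      (hF P).indexedCoeffs, Pi.single_apply, Pi.single_apply]
    split_ifs <;> simp
  have hsurj : Function.Surjective C := by
    intro y
    refine ⟨∑ P, y P • rationalHom (F P), ?_⟩
    rw [map_sum]
    simp only [map_smul, hCF]
    exact (pi_eq_sum_univ' y).symm
  rw [(LinearEquiv.ofBijective C ⟨hinj, hsurj⟩).finrank_eq, Module.finrank_fintype_fun_eq_card,
    Nat.card_eq_fintype_card]

end Multiplicity

end SetFamilies

theorem theorem1p3 (m n : ℕ) (hm : Odd m) (lam : YoungDiagram) (hlam : lam.card = m * n)
    (hmin : IsMinimalConstituent (foulkesChar m n) lam) :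
    (∀ P : Finset (Finset ℕ), IsSetFamily m n P → HasType P lam → IsClosedFamily P) ∧
    Finite (FamilyOfType m n lam) ∧
    (∀ ι : IndexedSymbol lam ≃ Fin (m * n),
      ∃ b : Module.Basis (FamilyOfType m n lam) ℤ (SpechtFoulkesHom m n lam),
        ∀ (P : FamilyOfType m n lam) (f : SpechtFoulkesHom m n lam),
          IsFamilyHom ι P f ↔ f = b P) ∧
    charInner (foulkesChar m n) (spechtChar lam (m * n)) =
      (Nat.card (FamilyOfType m n lam) : ℚ) := by
  have hX := noConstituentBelow_of_isMinimalConstituent hmin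
  -- Closedness, finiteness and the multiplicity do not refer to an identification of the symbols
  -- with points, so any one will do.
  let ι : IndexedSymbol lam ≃ Fin (m * n) := Fintype.equivFinOfCardEq (by
    rw [Fintype.card_coe]; exact hlam)
  exact ⟨fun P hP hT => isClosedFamily_of_noConstituentBelow hX ι ⟨P, hP, hT⟩,
    finite_familyOfType ι, exists_basis_isFamilyHom hm hX,
    charInner_foulkesChar_spechtChar hm hX ι⟩
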